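/- Let $\Gamma$ be a compact metric graph with finite vertex set $\mathcal V$ and finite edge set $\mathcal E$ (loops and multiple edges are allowed); each edge $e$ is identified with an interval $[0,l_e]$, $0<l_e<\infty$. Let $L_2(\Gamma)=\bigoplus_{e\in\mathcal E}L_2(e)$ be the real Hilbert space with inner product $(u,w)=\sum_{e}\int_e u_e w_e\,dx$, and let $\widetilde H^2(\Gamma)=\bigoplus_{e}H^2(e)$. Let $H:\Gamma\to\mathbb R$ be positive and Lipschitz with respect to the geodesic distance, with minimum $H_0$, and let $\kappa\in L_\infty(\Gamma)$ be real-valued with $\operatorname{ess\,inf}_\Gamma\kappa\ge\kappa_0$ for a constant $\kappa_0>0$. For $v\in\mathcal V$ let $d_v$ be the number of edge ends at $v$ (a loop at $v$ counts twice). For $u\in\widetilde H^2(\Gamma)$ let $F(v)\in\mathbb R^{d_v}$ be the vector of the values of $u$ at $v$ along these edge ends, and $F'(v)\in\mathbb R^{d_v}$ the vector of the derivatives of $u$ at $v$ along them, directed away from $v$. For each $v$ let $A_v,B_v$ be real $d_v\times d_v$ matrices such that the $d_v\times 2d_v$ matrix $(A_v,B_v)$ has rank $d_v$ and $A_vB_v^*$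 is self-adjoint. Let $\Lambda_v=B_v^{(-1)}A_v$, a self-adjoint operator on $R_v=\operatorname{Range}(B_v^*)=(\ker B_v)^\perp$, where $B_v^{(-1)}:\operatorname{Range}(B_v)\to R_v$ is the inverse of the bijection $R_v\to\operatorname{Range}(B_v)$ induced by $B_v$; put $S=\max_{v\in\mathcal V}\|\Lambda_v\|_2$, where $\|\cdot\|_2$ is the operator norm with respect to the Euclidean norm. Let $L$ be the operator in $L_2(\Gamma)$ with domain $$D(L)=\{u\in\widetilde H^2(\Gamma): A_vF(v)+H(v)B_vF'(v)=0\ \text{ for all } v\in\mathcal V\},$$ given on each edge $e$ by $(Lu)_e=\kappa_e^2u_e-\frac{d}{dx}\bigl(H_e\frac{d}{dx}u_e\bigr)$. **Theorem.** Suppose that at least one of the following holds: 1. $\kappa_0^2>4S\,l_{\min}^{-1}$ and $2S\,l_{\max}\le H_0$, where $l_{\min}=\min_{e}l_e$ and $l_{\max}=\max_e l_e$; 2. for every $v\in\mathcal V$ the operator $\Lambda_v$ is non-positive, i.e. $\langle\Lambda_vx,x\rangle\le 0$ for all $x\in R_v$. Then $L$ is densely defined, self-adjoint, and positive definite, that is,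 $(Lu,u)>0$ for all $0\ne u\in D(L)$. Moreover $L$ is a bijection from $D(L)$ onto $L_2(\Gamma)$, and its inverse is a compact operator on $L_2(\Gamma)$. -/

import Mathlib

open MeasureTheory Set
open scoped ENNReal NNReal ContDiff

noncomputable section

/-! ### Sobolev spaces on a bounded interval -/

/-- Lebesgue measure on the interval `(0, l)`; the end points are null sets. -/
abbrev intervalMeasure (l : ℝ) : Measure ℝ := volume.restrict (Ioo 0 l)

/-- The real Hilbert space `L₂(0, l)`. -/
abbrev L2Interval (l : ℝ) : Type := Lp ℝ 2 (intervalMeasure l)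

/-- `g` is a weak derivative of `u` on `(0, l)`. -/
def HasWeakDeriv (l : ℝ) (u g : ℝ → ℝ) : Prop :=
  ∀ φ : ℝ → ℝ, ContDiff ℝ ∞ φ → HasCompactSupport φ → tsupport φ ⊆ Ioo 0 l →
    ∫ x in Ioo 0 l, u x * deriv φ x = - ∫ x in Ioo 0 l, g x * φ x

lemma HasWeakDeriv.congr {l : ℝ} {u u' g g' : ℝ → ℝ} (h : HasWeakDeriv l u g)
    (hu : u =ᵐ[intervalMeasure l] u') (hg : g =ᵐ[intervalMeasure l] g') :
    HasWeakDeriv l u' g' := by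
  intro φ h1 h2 h3
  have e1 : ∫ x in Ioo 0 l, u' x * deriv φ x = ∫ x in Ioo 0 l, u x * deriv φ x :=
    integral_congr_ae (by filter_upwards [hu] with x hx; rw [hx])
  have e2 : ∫ x in Ioo 0 l, g' x * φ x = ∫ x in Ioo 0 l, g x * φ x :=
    integral_congr_ae (by filter_upwards [hg] with x hx; rw [hx])
  rw [e1, e2]
  exact h φ h1 h2 h3

lemma integrableOn_mul_continuous {l : ℝ} {u φ : ℝ → ℝ} (hu : IntegrableOn u (Ioo 0 l))
    (hφ : Continuous φ) : IntegrableOn (fun x => u x * φ x) (Ioo 0 l) := by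
  obtain ⟨C, hC⟩ := (isCompact_Icc (a := (0 : ℝ)) (b := l)).exists_bound_of_continuousOn
    hφ.continuousOn
  refine Integrable.mul_bdd (c := C) hu hφ.aestronglyMeasurable ?_
  filter_upwards [ae_restrict_mem measurableSet_Ioo] with x hx
  exact hC x (Ioo_subset_Icc_self hx)

lemma L2Interval.integrableOn {l : ℝ} (u : L2Interval l) : IntegrableOn u (Ioo 0 l) :=
  (Lp.memLp u).integrable (by norm_num)

lemma HasWeakDeriv.add {l : ℝ} {u u' g g' : ℝ → ℝ} (h : HasWeakDeriv l u g)
    (h' : HasWeakDeriv l u' g') (hu : IntegrableOn u (Ioo 0 l)) (hu' : IntegrableOn u' (Ioo 0 l))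
    (hg : IntegrableOn g (Ioo 0 l)) (hg' : IntegrableOn g' (Ioo 0 l)) :
    HasWeakDeriv l (u + u') (g + g') := by
  intro φ h1 h2 h3
  have hd : Continuous (deriv φ) := h1.continuous_deriv (by simp)
  simp only [Pi.add_apply, add_mul]
  rw [integral_add (integrableOn_mul_continuous hu hd) (integrableOn_mul_continuous hu' hd),
    integral_add (integrableOn_mul_continuous hg h1.continuous)
      (integrableOn_mul_continuous hg' h1.continuous), h φ h1 h2 h3, h' φ h1 h2 h3]
  ring

lemma HasWeakDeriv.const_smul {l : ℝ} {u g : ℝ → ℝ} (h : HasWeakDeriv l u g) (c : ℝ) :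
    HasWeakDeriv l (c • u) (c • g) := by
  intro φ h1 h2 h3
  simp only [Pi.smul_apply, smul_eq_mul, mul_assoc]
  rw [integral_const_mul, integral_const_mul, h φ h1 h2 h3]
  ring

/-- An integrable function on `(0, l)` that integrates to zero against all test functions
vanishes almost everywhere. -/
lemma ae_zero_of_integral_test {l : ℝ} {u : ℝ → ℝ} (hu : IntegrableOn u (Ioo 0 l))
    (h : ∀ φ : ℝ → ℝ, ContDiff ℝ ∞ φ → HasCompactSupport φ → tsupport φ ⊆ Ioo 0 l →
      ∫ x in Ioo 0 l, u x * φ x = 0) : u =ᵐ[intervalMeasure l] 0 := by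
  have := isOpen_Ioo.ae_eq_zero_of_integral_contDiff_smul_eq_zero (μ := volume)
    (U := Ioo 0 l) (f := u) hu.locallyIntegrableOn (fun φ h1 h2 h3 => by
      rw [← h φ h1 h2 h3, ← integral_indicator measurableSet_Ioo]
      refine integral_congr_ae (Filter.Eventually.of_forall fun x => ?_)
      by_cases hx : x ∈ Ioo 0 l
      · simp [hx, mul_comm]
      · have : φ x = 0 := image_eq_zero_of_notMem_tsupport fun h' => hx (h3 h')
        simp [hx, this])
  exact (ae_restrict_iff' measurableSet_Ioo).2 this

lemma HasWeakDeriv.unique {l : ℝ} {u : ℝ → ℝ} {g g' : L2Interval l} (h : HasWeakDeriv l u g)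
    (h' : HasWeakDeriv l u g') : g = g' := by
  have hi := g.integrableOn
  have hi' := g'.integrableOn
  have : (fun x => g x - g' x) =ᵐ[intervalMeasure l] 0 := by
    refine ae_zero_of_integral_test (hi.sub hi') fun φ h1 h2 h3 => ?_
    simp only [sub_mul]
    rw [integral_sub (integrableOn_mul_continuous hi h1.continuous)
      (integrableOn_mul_continuous hi' h1.continuous)]
    have e1 := h φ h1 h2 h3
    have e2 := h' φ h1 h2 h3
    linarith
  apply Lp.ext
  filter_upwards [this] with x hx
  simpa [sub_eq_zero] using hx

/-- An absolutely continuous function is weakly differentiable. -/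
lemma hasWeakDeriv_of_ac {l : ℝ} (hl : 0 < l) {f : ℝ → ℝ}
    (hf : AbsolutelyContinuousOnInterval f 0 l) : HasWeakDeriv l f (deriv f) := by
  intro φ h1 h2 h3
  have hφ : AbsolutelyContinuousOnInterval φ 0 l :=
    (h1.of_le (by exact_mod_cast le_top)).contDiffOn.absolutelyContinuousOnInterval
  have := hf.integral_mul_deriv_eq_deriv_mul hφ
  have z0 : φ 0 = 0 := image_eq_zero_of_notMem_tsupport fun h' => by simpa using (h3 h')
  have zl : φ l = 0 := image_eq_zero_of_notMem_tsupport fun h' => by simpa using (h3 h')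
  rw [z0, zl, intervalIntegral.integral_of_le hl.le, intervalIntegral.integral_of_le hl.le,
    integral_Ioc_eq_integral_Ioo, integral_Ioc_eq_integral_Ioo] at this
  rw [this]; ring

lemma ac_primitive {l : ℝ} (hl : 0 < l) {g : ℝ → ℝ} (hg : IntegrableOn g (Ioo 0 l)) (c : ℝ) :
    AbsolutelyContinuousOnInterval (fun x => c + ∫ t in (0 : ℝ)..x, g t) 0 l ∧
      deriv (fun x => c + ∫ t in (0 : ℝ)..x, g t) =ᵐ[intervalMeasure l] g := by
  have hi : IntervalIntegrable g volume 0 l :=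
    (intervalIntegrable_iff_integrableOn_Ioo_of_le hl.le).2 hg
  constructor
  · exact ((LipschitzWith.const' (K := 0) c).lipschitzOnWith.absolutelyContinuousOnInterval).fun_add
      (hi.absolutelyContinuousOnInterval_intervalIntegral (by simp))
  · refine (ae_restrict_iff' measurableSet_Ioo).2 ?_
    filter_upwards [hi.ae_hasDerivAt_integral] with x hx hx'
    have := hx (by rw [uIcc_of_le hl.le]; exact Ioo_subset_Icc_self hx') 0 (by simp)
    exact (this.const_add c).deriv

/-- A weakly differentiable function has an absolutely continuous representative. -/
lemma HasWeakDeriv.exists_primitive {l : ℝ} (hl : 0 < l) {u g : ℝ → ℝ}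
    (hu : IntegrableOn u (Ioo 0 l)) (hg : IntegrableOn g (Ioo 0 l)) (h : HasWeakDeriv l u g) :
    ∃ c : ℝ, u =ᵐ[intervalMeasure l] fun x => c + ∫ t in (0 : ℝ)..x, g t := by
  obtain ⟨hGac, hGd⟩ := ac_primitive hl hg 0
  simp only [zero_add] at hGac hGd
  set G : ℝ → ℝ := fun x => ∫ t in (0 : ℝ)..x, g t with hG
  have hGi : IntegrableOn G (Ioo 0 l) := by
    have := hGac.continuousOn
    rw [uIcc_of_le hl.le] at this
    exact (this.integrableOn_Icc).mono_set Ioo_subset_Icc_self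
  have hGw : HasWeakDeriv l G g := (hasWeakDeriv_of_ac hl hGac).congr (ae_eq_refl _) hGd
  set w : ℝ → ℝ := fun x => u x - G x with hw
  have hwi : IntegrableOn w (Ioo 0 l) := hu.sub hGi
  have hw0 : ∀ φ : ℝ → ℝ, ContDiff ℝ ∞ φ → HasCompactSupport φ → tsupport φ ⊆ Ioo 0 l →
      ∫ x in Ioo 0 l, w x * deriv φ x = 0 := by
    intro φ h1 h2 h3
    have hd : Continuous (deriv φ) := h1.continuous_deriv (by simp)
    simp only [hw, sub_mul]
    rw [integral_sub (integrableOn_mul_continuous hu hd) (integrableOn_mul_continuous hGi hd),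
      h φ h1 h2 h3, hGw φ h1 h2 h3]
    ring
  -- a bump function of integral one
  let b : ContDiffBump (l / 2) := ⟨l / 8, l / 4, by positivity, by linarith⟩
  let ψ₀ : ℝ → ℝ := b.normed volume
  have hψ₀ : ContDiff ℝ ∞ ψ₀ := b.contDiff_normed
  have hψ₀s : tsupport ψ₀ ⊆ Ioo 0 l := by
    rw [b.tsupport_normed_eq, Real.closedBall_eq_Icc]
    intro x hx
    have h1 := hx.1
    have h2 := hx.2
    simp only [b] at h1 h2
    constructor <;> linarith
  have hψ₀c : HasCompactSupport ψ₀ := b.hasCompactSupport_normed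
  have hψ₀i : ∫ x in Ioo 0 l, ψ₀ x = 1 := by
    rw [setIntegral_eq_integral_of_forall_compl_eq_zero
      (fun x hx => image_eq_zero_of_notMem_tsupport fun h' => hx (hψ₀s h'))]
    exact b.integral_normed
  refine ⟨∫ x in Ioo 0 l, w x * ψ₀ x, ?_⟩
  set c := ∫ x in Ioo 0 l, w x * ψ₀ x with hc
  have key : (fun x => w x - c) =ᵐ[intervalMeasure l] 0 := by
    have hci : IntegrableOn (fun _ : ℝ => c) (Ioo 0 l) := integrableOn_const (by simp)
    refine ae_zero_of_integral_test (hwi.sub hci) fun ψ h1 h2 h3 => ?_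
    set m := ∫ x in Ioo 0 l, ψ x with hm
    set η : ℝ → ℝ := fun x => ψ x - m * ψ₀ x with hη
    have hηs : ContDiff ℝ ∞ η := h1.sub (contDiff_const.mul hψ₀)
    have hηz : ∀ x, x ∉ tsupport ψ ∪ tsupport ψ₀ → η x = 0 := by
      intro x hx
      simp only [mem_union, not_or] at hx
      simp [hη, image_eq_zero_of_notMem_tsupport hx.1, image_eq_zero_of_notMem_tsupport hx.2]
    have hK : IsCompact (tsupport ψ ∪ tsupport ψ₀) := h2.isCompact.union hψ₀c.isCompact
    have hKs : tsupport ψ ∪ tsupport ψ₀ ⊆ Ioo 0 l := union_subset h3 hψ₀s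
    obtain ⟨p, q, hp, hq, hpq, hKpq⟩ : ∃ p q : ℝ, 0 < p ∧ q < l ∧ p ≤ q ∧
        tsupport ψ ∪ tsupport ψ₀ ⊆ Icc p q := by
      have hne : (tsupport ψ ∪ tsupport ψ₀).Nonempty := by
        by_contra hcon
        rw [Set.not_nonempty_iff_eq_empty] at hcon
        have : ∀ x, ψ₀ x = 0 := fun x => image_eq_zero_of_notMem_tsupport fun h' => by
          have : x ∈ tsupport ψ ∪ tsupport ψ₀ := Or.inr h'
          simp [hcon] at this
        simp [this] at hψ₀i
      obtain ⟨p, hp, hp'⟩ := hK.exists_isLeast hne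
      obtain ⟨q, hq, hq'⟩ := hK.exists_isGreatest hne
      exact ⟨p, q, (hKs hp).1, (hKs hq).2, hp' hq, fun x hx => ⟨hp' hx, hq' hx⟩⟩
    have hηi : ∀ a b : ℝ, IntervalIntegrable η volume a b :=
      fun a b => hηs.continuous.intervalIntegrable a b
    set φ : ℝ → ℝ := fun x => ∫ t in p..x, η t with hφ
    have hφd : ∀ x, HasDerivAt φ (η x) x := fun x =>
      intervalIntegral.integral_hasDerivAt_right (hηi _ _)
        (hηs.continuous.stronglyMeasurableAtFilter _ _) hηs.continuous.continuousAt
    have hφderiv : deriv φ = η := funext fun x => (hφd x).deriv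
    have hφs : ContDiff ℝ ∞ φ := by
      rw [contDiff_infty_iff_deriv]
      exact ⟨fun x => (hφd x).differentiableAt, by rw [hφderiv]; exact hηs⟩
    have hηpq : ∀ x, x ∉ Icc p q → η x = 0 := fun x hx => hηz x fun h' => hx (hKpq h')
    have htot : ∫ t in p..q, η t = 0 := by
      have hz : ∫ t in Ioo 0 l, η t = 0 := by
        simp only [hη]
        rw [integral_sub, integral_const_mul, hψ₀i, ← hm]
        · ring
        · exact h1.continuous.integrable_of_hasCompactSupport h2 |>.integrableOn
        · exact ((hψ₀.continuous.integrable_of_hasCompactSupport hψ₀c).const_mul m).integrableOn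
      rw [intervalIntegral.integral_of_le hpq, ← integral_Icc_eq_integral_Ioc, ← hz]
      rw [setIntegral_eq_integral_of_forall_compl_eq_zero hηpq,
        setIntegral_eq_integral_of_forall_compl_eq_zero
          (fun x hx => hηz x fun h' => hx (hKs h'))]
    have hφz : ∀ x, x ∉ Icc p q → φ x = 0 := by
      intro x hx
      rcases lt_or_ge x p with hxp | hxp
      · simp only [hφ]
        rw [intervalIntegral.integral_symm, neg_eq_zero, intervalIntegral.integral_of_le hxp.le,
          integral_Ioc_eq_integral_Ioo]
        refine setIntegral_eq_zero_of_forall_eq_zero fun t ht => hηpq t fun h' => ?_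
        exact absurd ht.2 (not_lt.2 h'.1)
      · have hxq : q < x := by
          by_contra hcon
          exact hx ⟨hxp, not_lt.1 hcon⟩
        simp only [hφ]
        rw [← intervalIntegral.integral_add_adjacent_intervals (hηi p q) (hηi q x), htot, zero_add,
          intervalIntegral.integral_of_le hxq.le]
        refine setIntegral_eq_zero_of_forall_eq_zero fun t ht => hηpq t fun h' => ?_
        exact absurd ht.1 (not_lt.2 h'.2)
    have hφt : tsupport φ ⊆ Icc p q :=
      closure_minimal (fun x hx => by
        by_contra hcon
        exact hx (hφz x hcon)) isClosed_Icc
    have hφc : HasCompactSupport φ := HasCompactSupport.of_support_subset_isCompact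
      (isCompact_Icc (a := p) (b := q)) ((subset_tsupport φ).trans hφt)
    have := hw0 φ hφs hφc (hφt.trans fun x hx => ⟨hp.trans_le hx.1, hx.2.trans_lt hq⟩)
    rw [hφderiv] at this
    simp only [hη, mul_sub] at this
    have i1 := integrableOn_mul_continuous hwi h1.continuous
    have i2 := integrableOn_mul_continuous hwi (φ := fun x => m * ψ₀ x)
      (continuous_const.mul hψ₀.continuous)
    rw [integral_sub i1 i2] at this
    have e3 : ∫ x in Ioo 0 l, w x * (m * ψ₀ x) = m * c := by
      rw [hc, ← integral_const_mul]
      congr 1; ext x; ring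
    simp only [sub_mul]
    rw [integral_sub i1 (integrableOn_mul_continuous hci h1.continuous), integral_const_mul, ← hm]
    linarith
  filter_upwards [key] with x hx
  simp only [hw, Pi.zero_apply] at hx
  linarith

/-- `H¹(0, l)` as a subspace of `L₂(0, l)`. -/
def H1Interval (l : ℝ) : Submodule ℝ (L2Interval l) where
  carrier := {u | ∃ g : L2Interval l, HasWeakDeriv l u g}
  zero_mem' := ⟨0, by
    refine HasWeakDeriv.congr (u := fun _ => 0) (g := fun _ => 0) ?_
      (Lp.coeFn_zero ℝ 2 _).symm (Lp.coeFn_zero ℝ 2 _).symm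
    intro φ _ _ _
    simp⟩
  add_mem' := by
    rintro u v ⟨g, hg⟩ ⟨k, hk⟩
    exact ⟨g + k, (hg.add hk u.integrableOn v.integrableOn g.integrableOn k.integrableOn).congr
      (Lp.coeFn_add u v).symm (Lp.coeFn_add g k).symm⟩
  smul_mem' := by
    rintro c u ⟨g, hg⟩
    exact ⟨c • g, (hg.const_smul c).congr (Lp.coeFn_smul c u).symm (Lp.coeFn_smul c g).symm⟩

open Classical in
/-- The weak derivative of `u ∈ H¹(0, l)` (and `0` if `u` is not in `H¹(0, l)`). -/
def weakDeriv {l : ℝ} (u : L2Interval l) : L2Interval l :=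
  if h : ∃ g : L2Interval l, HasWeakDeriv l u g then h.choose else 0

lemma weakDeriv_spec {l : ℝ} {u : L2Interval l} (hu : u ∈ H1Interval l) :
    HasWeakDeriv l u (weakDeriv u) := by
  have h : ∃ g : L2Interval l, HasWeakDeriv l u g := hu
  rw [weakDeriv, dif_pos h]
  exact h.choose_spec

lemma weakDeriv_eq {l : ℝ} {u g : L2Interval l} (h : HasWeakDeriv l u g) : weakDeriv u = g :=
  (weakDeriv_spec ⟨g, h⟩).unique h

lemma weakDeriv_add {l : ℝ} {u v : L2Interval l} (hu : u ∈ H1Interval l)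
    (hv : v ∈ H1Interval l) : weakDeriv (u + v) = weakDeriv u + weakDeriv v :=
  weakDeriv_eq (((weakDeriv_spec hu).add (weakDeriv_spec hv) u.integrableOn v.integrableOn
    (weakDeriv u).integrableOn (weakDeriv v).integrableOn).congr
      (Lp.coeFn_add u v).symm (Lp.coeFn_add _ _).symm)

lemma weakDeriv_smul {l : ℝ} (c : ℝ) {u : L2Interval l} (hu : u ∈ H1Interval l) :
    weakDeriv (c • u) = c • weakDeriv u :=
  weakDeriv_eq (((weakDeriv_spec hu).const_smul c).congr
    (Lp.coeFn_smul c u).symm (Lp.coeFn_smul c _).symm)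

/-- `H²(0, l)` as a subspace of `L₂(0, l)`. -/
def H2Interval (l : ℝ) : Submodule ℝ (L2Interval l) where
  carrier := {u | u ∈ H1Interval l ∧ weakDeriv u ∈ H1Interval l}
  zero_mem' := ⟨zero_mem _, by
    have h : weakDeriv (0 : L2Interval l) = 0 := by
      have := weakDeriv_smul (0 : ℝ) (zero_mem (H1Interval l))
      simpa using this
    rw [h]; exact zero_mem _⟩
  add_mem' := by
    rintro u v ⟨hu, hu'⟩ ⟨hv, hv'⟩
    exact ⟨add_mem hu hv, by rw [weakDeriv_add hu hv]; exact add_mem hu' hv'⟩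
  smul_mem' := by
    rintro c u ⟨hu, hu'⟩
    exact ⟨Submodule.smul_mem _ c hu, by
      rw [weakDeriv_smul c hu]; exact Submodule.smul_mem _ c hu'⟩

/-- `f` is a representative of `u` that is continuous on the closed interval `[0, l]`. -/
def IsContRep {l : ℝ} (u : L2Interval l) (f : ℝ → ℝ) : Prop :=
  ContinuousOn f (Icc 0 l) ∧ u =ᵐ[intervalMeasure l] f

open Classical in
/-- The representative of `u` that is continuous on `[0, l]`; every `u ∈ H¹(0, l)` has one, and
its values on `[0, l]` are unique (if there is none, the value is `0`). -/
def contRep {l : ℝ} (u : L2Interval l) : ℝ → ℝ :=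
  if h : ∃ f : ℝ → ℝ, IsContRep u f then h.choose else 0

lemma exists_isContRep {l : ℝ} (hl : 0 < l) {u : L2Interval l} (hu : u ∈ H1Interval l) :
    ∃ f : ℝ → ℝ, IsContRep u f := by
  obtain ⟨c, hc⟩ := (weakDeriv_spec hu).exists_primitive hl u.integrableOn
    (weakDeriv u).integrableOn
  refine ⟨_, ?_, hc⟩
  have := (ac_primitive hl (weakDeriv u).integrableOn c).1.continuousOn
  rwa [uIcc_of_le hl.le] at this

lemma isContRep_contRep {l : ℝ} (hl : 0 < l) {u : L2Interval l} (hu : u ∈ H1Interval l) :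
    IsContRep u (contRep u) := by
  have h := exists_isContRep hl hu
  rw [contRep, dif_pos h]
  exact h.choose_spec

lemma IsContRep.eqOn {l : ℝ} (hl : 0 < l) {u : L2Interval l} {f g : ℝ → ℝ}
    (hf : IsContRep u f) (hg : IsContRep u g) : EqOn f g (Icc 0 l) := by
  refine Measure.eqOn_Icc_of_ae_eq volume hl.ne ?_ hf.1 hg.1
  rw [← restrict_Ioo_eq_restrict_Icc]
  exact hf.2.symm.trans hg.2

lemma contRep_add {l : ℝ} (hl : 0 < l) {u v : L2Interval l} (hu : u ∈ H1Interval l)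
    (hv : v ∈ H1Interval l) {x : ℝ} (hx : x ∈ Icc 0 l) :
    contRep (u + v) x = contRep u x + contRep v x := by
  have h1 := isContRep_contRep hl hu
  have h2 := isContRep_contRep hl hv
  have h3 : IsContRep (u + v) (contRep u + contRep v) :=
    ⟨h1.1.add h2.1, (Lp.coeFn_add u v).trans (h1.2.add h2.2)⟩
  exact (isContRep_contRep hl (add_mem hu hv)).eqOn hl h3 hx

lemma contRep_smul {l : ℝ} (hl : 0 < l) (c : ℝ) {u : L2Interval l} (hu : u ∈ H1Interval l)
    {x : ℝ} (hx : x ∈ Icc 0 l) : contRep (c • u) x = c * contRep u x := by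
  have h1 := isContRep_contRep hl hu
  have h3 : IsContRep (c • u) (c • contRep u) :=
    ⟨h1.1.const_smul c, (Lp.coeFn_smul c u).trans (h1.2.const_smul c)⟩
  exact (isContRep_contRep hl (Submodule.smul_mem _ c hu)).eqOn hl h3 hx

/-- A Lipschitz function as an element of `L∞(0, l)`. -/
lemma memLp_of_lipschitz {l : ℝ} {h : ℝ → ℝ} (hh : ∃ K : ℝ≥0, LipschitzWith K h) :
    MemLp h ∞ (intervalMeasure l) := by
  obtain ⟨K, hK⟩ := hh
  obtain ⟨C, hC⟩ := (isCompact_Icc (a := (0 : ℝ)) (b := l)).exists_bound_of_continuousOn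
    hK.continuous.continuousOn
  refine memLp_top_of_bound hK.continuous.aestronglyMeasurable C ?_
  filter_upwards [ae_restrict_mem measurableSet_Ioo] with x hx
  exact hC x (Ioo_subset_Icc_self hx)

/-- Multiplication by a Lipschitz function preserves `H¹(0, l)`. -/
lemma lipschitz_smul_mem_H1 {l : ℝ} (hl : 0 < l) {h : ℝ → ℝ} (hh : ∃ K : ℝ≥0, LipschitzWith K h)
    {u : L2Interval l} (hu : u ∈ H1Interval l) :
    ((memLp_of_lipschitz (l := l) hh).toLp h • u : L2Interval l) ∈ H1Interval l := by
  obtain ⟨K, hK⟩ := id hh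
  obtain ⟨c, hc⟩ := (weakDeriv_spec hu).exists_primitive hl u.integrableOn
    (weakDeriv u).integrableOn
  obtain ⟨fac, fd⟩ := ac_primitive hl (weakDeriv u).integrableOn c
  set f : ℝ → ℝ := fun x => c + ∫ t in (0 : ℝ)..x, (weakDeriv u) t with hf
  have hac : AbsolutelyContinuousOnInterval h 0 l :=
    (hK.lipschitzOnWith (s := uIcc 0 l)).absolutelyContinuousOnInterval
  have hd : deriv (fun x => h x * f x) =ᵐ[intervalMeasure l]
      fun x => deriv h x * u x + h x * (weakDeriv u) x := by
    have a1 := ae_restrict_of_ae (s := Ioo 0 l) hac.ae_differentiableAt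
    have a2 := ae_restrict_of_ae (s := Ioo 0 l) fac.ae_differentiableAt
    filter_upwards [a1, a2, hc, fd, ae_restrict_mem measurableSet_Ioo] with x h1 h2 h3 h4 h5
    have hx : x ∈ uIcc 0 l := by rw [uIcc_of_le hl.le]; exact Ioo_subset_Icc_self h5
    have := ((h1 hx).hasDerivAt.mul (h2 hx).hasDerivAt).deriv
    rw [h4, ← h3] at this
    exact this
  have hm1 : MemLp (fun x => deriv h x * u x) 2 (intervalMeasure l) := by
    have : MemLp (deriv h) ∞ (intervalMeasure l) :=
      memLp_top_of_bound (measurable_deriv h).aestronglyMeasurable K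
        (Filter.Eventually.of_forall fun x => norm_deriv_le_of_lipschitz hK)
    exact (Lp.memLp u).mul this
  have hm2 : MemLp (fun x => h x * (weakDeriv u) x) 2 (intervalMeasure l) :=
    (Lp.memLp (weakDeriv u)).mul (memLp_of_lipschitz hh)
  have hm := hm1.add hm2
  refine ⟨hm.toLp _, (hasWeakDeriv_of_ac hl (hac.fun_mul fac)).congr ?_
    (hd.trans hm.coeFn_toLp.symm)⟩
  refine Filter.EventuallyEq.symm ?_
  filter_upwards [Lp.coeFn_lpSMul (r := 2) ((memLp_of_lipschitz (l := l) hh).toLp h) u,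
    (memLp_of_lipschitz (l := l) hh).coeFn_toLp, hc] with x h1 h2 h3
  rw [h1]
  simp only [Pi.smul_apply', smul_eq_mul]
  rw [h2, h3]

/-! ### Compact metric graphs -/

/-- A metric graph with vertex set `V` and edge set `E`, both assumed finite where compactness is
needed; loops and multiple edges are allowed. The edge `e` is identified with the interval
`[0, len e]`; its coordinate `0` sits at the vertex `endpoint e false`, and its coordinate `len e`
at the vertex `endpoint e true`. -/
structure MetricGraph (V E : Type*) where
  endpoint : E → Bool → V
  len : E → ℝ
  len_pos : ∀ e, 0 < len e

namespace MetricGraph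

variable {V E : Type*} (G : MetricGraph V E)

/-- The coordinate of an end of the edge `e`. -/
def endCoord (e : E) (b : Bool) : ℝ := if b then G.len e else 0

lemma endCoord_mem (e : E) (b : Bool) : G.endCoord e b ∈ Icc 0 (G.len e) := by
  cases b <;> simp [endCoord, (G.len_pos e).le]

/-- The identification of the ends of the edges with vertices. -/
inductive Glue : V ⊕ (Σ e : E, Icc 0 (G.len e)) → V ⊕ (Σ e : E, Icc 0 (G.len e)) → Prop
  | mk (e : E) (b : Bool) :
      Glue (Sum.inr ⟨e, ⟨G.endCoord e b, G.endCoord_mem e b⟩⟩) (Sum.inl (G.endpoint e b))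

/-- The points of the metric graph. -/
def Point : Type _ := Quot G.Glue

/-- A vertex as a point of the metric graph. -/
def vertexPoint (v : V) : G.Point := Quot.mk _ (Sum.inl v)

/-- The point of the edge `e` with a given coordinate (for `x` outside of `[0, len e]`, the
nearest end of `e`). -/
def edgePoint (e : E) (x : ℝ) : G.Point :=
  Quot.mk _ (Sum.inr ⟨e, projIcc 0 (G.len e) (G.len_pos e).le x⟩)

/-- `G.Route p q r`: one can go from `p` to `q` along finitely many segments of edges of total
length `r`. -/
inductive Route : G.Point → G.Point → ℝ≥0∞ → Prop
  | refl (p : G.Point) : Route p p 0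
  | step (e : E) (x y : ℝ) (hx : x ∈ Icc 0 (G.len e)) (hy : y ∈ Icc 0 (G.len e))
      (q : G.Point) (r : ℝ≥0∞) (h : Route (G.edgePoint e y) q r) :
      Route (G.edgePoint e x) q (edist x y + r)

variable {G}

lemma Route.trans {p q s : G.Point} {r r' : ℝ≥0∞} (h : G.Route p q r) (h' : G.Route q s r') :
    G.Route p s (r + r') := by
  induction h with
  | refl p => simpa using h'
  | step e x y hx hy q r _ ih =>
    rw [add_assoc]
    exact Route.step e x y hx hy s _ (ih h')

lemma Route.symm {p q : G.Point} {r : ℝ≥0∞} (h : G.Route p q r) : G.Route q p r := by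
  induction h with
  | refl p => exact Route.refl p
  | step e x y hx hy q r _ ih =>
    have := Route.step e y x hy hx (G.edgePoint e x) 0 (Route.refl _)
    have h2 := ih.trans this
    rwa [add_zero, edist_comm, add_comm] at h2

variable (G)

/-- The geodesic distance: the infimum of the lengths of the routes between two points. -/
instance : PseudoEMetricSpace G.Point where
  edist p q := sInf {r | G.Route p q r}
  edist_self p := le_antisymm (sInf_le (Route.refl p)) bot_le
  edist_comm p q := by
    have : ∀ p q : G.Point, sInf {r | G.Route p q r} ≤ sInf {r | G.Route q p r} :=
      fun p q => le_sInf fun r hr => sInf_le (Route.symm hr)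
    exact le_antisymm (this p q) (this q p)
  edist_triangle p q s := by
    simp only [sInf_eq_iInf']
    rw [ENNReal.iInf_add]
    refine le_iInf fun r => ?_
    rw [ENNReal.add_iInf]
    refine le_iInf fun r' => ?_
    exact iInf_le (fun z : {r | G.Route p s r} => (z : ℝ≥0∞)) ⟨r + r', r.2.trans r'.2⟩

/-- The restriction to the edge `e` of a Lipschitz function on the graph is Lipschitz. -/
lemma lipschitz_edge {H : G.Point → ℝ} (hH : ∃ K : ℝ≥0, LipschitzWith K H) (e : E) :
    ∃ K : ℝ≥0, LipschitzWith K fun x => H (G.edgePoint e x) := by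
  obtain ⟨K, hK⟩ := hH
  have hproj : LipschitzWith 1 (projIcc 0 (G.len e) (G.len_pos e).le) := LipschitzWith.projIcc _
  have : LipschitzWith 1 (G.edgePoint e) := by
    intro x y
    have hsame : ∀ z : ℝ,
        G.edgePoint e (projIcc 0 (G.len e) (G.len_pos e).le z : ℝ) = G.edgePoint e z := by
      intro z
      rw [edgePoint, edgePoint, projIcc_val]
    rw [← hsame x, ← hsame y]
    rw [ENNReal.coe_one, one_mul]
    refine le_trans ?_ ((hproj x y).trans_eq (by rw [ENNReal.coe_one, one_mul]))
    rw [Subtype.edist_eq]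
    refine sInf_le ?_
    have := Route.step (G := G) e (projIcc 0 (G.len e) (G.len_pos e).le x)
      (projIcc 0 (G.len e) (G.len_pos e).le y) (Subtype.coe_prop _) (Subtype.coe_prop _) _ 0
      (Route.refl _)
    simpa using this
  exact ⟨K * 1, hK.comp this⟩

/-- The real Hilbert space `L₂(Γ)`, the orthogonal sum of the spaces `L₂(e)`. -/
abbrev L2 : Type _ := PiLp 2 fun e : E => L2Interval (G.len e)

/-- The space `L∞(Γ)` of bounded functions on the graph, edge by edge. -/
abbrev LInfty : Type _ := ∀ e : E, Lp ℝ ∞ (intervalMeasure (G.len e))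

/-- The edge ends at the vertex `v`: their number is the degree of `v`, where a loop at `v` has
two ends at `v`. -/
abbrev EdgeEnd (v : V) : Type _ := {p : E × Bool // G.endpoint p.1 p.2 = v}

variable {G}

/-- The vector `F(v)` of the values of `u` at `v` along the edge ends at `v`. -/
def boundaryValue (u : G.L2) (v : V) : G.EdgeEnd v → ℝ :=
  fun h => contRep (u h.1.1) (G.endCoord h.1.1 h.1.2)

/-- The vector `F'(v)` of the derivatives of `u` at `v`, directed away from `v`, along the edge
ends at `v`. -/
def boundaryDeriv (u : G.L2) (v : V) : G.EdgeEnd v → ℝ :=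
  fun h => (if h.1.2 then -1 else 1) *
    contRep (weakDeriv (u h.1.1)) (G.endCoord h.1.1 h.1.2)

lemma boundaryValue_add {u w : G.L2} (hu : ∀ e, u e ∈ H2Interval (G.len e))
    (hw : ∀ e, w e ∈ H2Interval (G.len e)) (v : V) :
    boundaryValue (u + w) v = boundaryValue u v + boundaryValue w v := by
  ext h
  exact contRep_add (G.len_pos _) (hu _).1 (hw _).1 (G.endCoord_mem _ _)

lemma boundaryDeriv_add {u w : G.L2} (hu : ∀ e, u e ∈ H2Interval (G.len e))
    (hw : ∀ e, w e ∈ H2Interval (G.len e)) (v : V) :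
    boundaryDeriv (u + w) v = boundaryDeriv u v + boundaryDeriv w v := by
  ext h
  simp only [boundaryDeriv, PiLp.add_apply, Pi.add_apply]
  rw [weakDeriv_add (hu _).1 (hw _).1,
    contRep_add (G.len_pos _) (hu _).2 (hw _).2 (G.endCoord_mem _ _), mul_add]

lemma boundaryValue_smul (c : ℝ) {u : G.L2} (hu : ∀ e, u e ∈ H2Interval (G.len e)) (v : V) :
    boundaryValue (c • u) v = c • boundaryValue u v := by
  ext h
  exact contRep_smul (G.len_pos _) c (hu _).1 (G.endCoord_mem _ _)

lemma boundaryDeriv_smul (c : ℝ) {u : G.L2} (hu : ∀ e, u e ∈ H2Interval (G.len e)) (v : V) :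
    boundaryDeriv (c • u) v = c • boundaryDeriv u v := by
  ext h
  simp only [boundaryDeriv, PiLp.smul_apply, Pi.smul_apply, smul_eq_mul]
  rw [weakDeriv_smul c (hu _).1,
    contRep_smul (G.len_pos _) c (hu _).2 (G.endCoord_mem _ _)]
  ring

variable (G)
variable [Fintype E] [DecidableEq V]

/-- The domain of the operator: all `u` that are in `H²` of every edge and satisfy
`A_v F(v) + H(v) B_v F'(v) = 0` at every vertex `v`. -/
def operatorDomain (H : G.Point → ℝ) (A B : ∀ v, Matrix (G.EdgeEnd v) (G.EdgeEnd v) ℝ) :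
    Submodule ℝ G.L2 where
  carrier := {u | (∀ e, u e ∈ H2Interval (G.len e)) ∧
    ∀ v, (A v).mulVec (boundaryValue u v) +
      H (G.vertexPoint v) • (B v).mulVec (boundaryDeriv u v) = 0}
  zero_mem' := by
    have h0 : ∀ e, (0 : G.L2) e ∈ H2Interval (G.len e) := fun e => zero_mem _
    refine ⟨h0, fun v => ?_⟩
    have h1 := boundaryValue_smul 0 h0 v
    have h2 := boundaryDeriv_smul 0 h0 v
    rw [zero_smul, zero_smul] at h1 h2
    rw [h1, h2]; simp
  add_mem' := by
    rintro u w ⟨hu, hu'⟩ ⟨hw, hw'⟩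
    refine ⟨fun e => add_mem (hu e) (hw e), fun v => ?_⟩
    rw [boundaryValue_add hu hw, boundaryDeriv_add hu hw, Matrix.mulVec_add, Matrix.mulVec_add,
      smul_add, add_add_add_comm, hu' v, hw' v, add_zero]
  smul_mem' := by
    rintro c u ⟨hu, hu'⟩
    refine ⟨fun e => Submodule.smul_mem _ c (hu e), fun v => ?_⟩
    rw [boundaryValue_smul c hu, boundaryDeriv_smul c hu, Matrix.mulVec_smul, Matrix.mulVec_smul,
      smul_comm _ c, ← smul_add, hu' v, smul_zero]

/-- The Lipschitz function `H`, restricted to the edge `e`, as an element of `L∞(e)`. -/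
def edgeCoeff {H : G.Point → ℝ} (hH : ∃ K : ℝ≥0, LipschitzWith K H) (e : E) :
    Lp ℝ ∞ (intervalMeasure (G.len e)) :=
  (memLp_of_lipschitz (G.lipschitz_edge hH e)).toLp fun x => H (G.edgePoint e x)

/-- The operator `L u = κ² u - ∇(H ∇u)` in `L₂(Γ)`, with the vertex conditions given by the
matrices `A_v`, `B_v`. -/
def operator (H : G.Point → ℝ) (hH : ∃ K : ℝ≥0, LipschitzWith K H) (κ : G.LInfty)
    (A B : ∀ v, Matrix (G.EdgeEnd v) (G.EdgeEnd v) ℝ) : G.L2 →ₗ.[ℝ] G.L2 where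
  domain := G.operatorDomain H A B
  toFun :=
    { toFun := fun u => WithLp.toLp 2 fun e =>
        (κ e • (κ e • u.1 e : L2Interval (G.len e)) : L2Interval (G.len e)) -
          weakDeriv (G.edgeCoeff hH e • weakDeriv (u.1 e) : L2Interval (G.len e))
      map_add' := by
        intro u w
        ext1 e
        have h1 := lipschitz_smul_mem_H1 (G.len_pos e) (G.lipschitz_edge hH e) (u.2.1 e).2
        have h2 := lipschitz_smul_mem_H1 (G.len_pos e) (G.lipschitz_edge hH e) (w.2.1 e).2
        simp only [Submodule.coe_add, PiLp.add_apply]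
        rw [weakDeriv_add (u.2.1 e).1 (w.2.1 e).1, Lp.add_smul, Lp.add_smul, Lp.add_smul,
          edgeCoeff, weakDeriv_add h1 h2]
        abel
      map_smul' := by
        intro c u
        ext1 e
        have h1 := lipschitz_smul_mem_H1 (G.len_pos e) (G.lipschitz_edge hH e) (u.2.1 e).2
        simp only [Submodule.coe_smul, PiLp.smul_apply, RingHom.id_apply]
        rw [weakDeriv_smul c (u.2.1 e).1, ← Lp.smul_comm, ← Lp.smul_comm, ← Lp.smul_comm,
          edgeCoeff, weakDeriv_smul c h1, smul_sub] }

end MetricGraph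

/-! ### The operators `Λ_v` -/

section Lambda

variable {n : Type*} [Fintype n] [DecidableEq n]

/-- The range `R` of `B*`, the orthogonal complement of the kernel of `B`. -/
def rangeAdj (B : Matrix n n ℝ) : Submodule ℝ (EuclideanSpace ℝ n) :=
  LinearMap.range (Matrix.toEuclideanLin B.conjTranspose)

/-- The range `R₁` of `B`. -/
def rangeMat (B : Matrix n n ℝ) : Submodule ℝ (EuclideanSpace ℝ n) :=
  LinearMap.range (Matrix.toEuclideanLin B)

/-- The map `R → R₁` induced by `B`. -/
def restrictedMap (B : Matrix n n ℝ) : rangeAdj B →ₗ[ℝ] rangeMat B :=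
  (Matrix.toEuclideanLin B).rangeRestrict ∘ₗ (rangeAdj B).subtype

lemma restrictedMap_bijective (B : Matrix n n ℝ) : Function.Bijective (restrictedMap B) := by
  have hinj : Function.Injective (restrictedMap B) := by
    rw [← LinearMap.ker_eq_bot, LinearMap.ker_eq_bot']
    rintro ⟨x, y, rfl⟩ hx
    have h0 : Matrix.toEuclideanLin B (Matrix.toEuclideanLin B.conjTranspose y) = 0 :=
      congrArg Subtype.val hx
    have h1 : inner ℝ (Matrix.toEuclideanLin B.conjTranspose y)
        (Matrix.toEuclideanLin B.conjTranspose y) = 0 := by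
      rw [Matrix.toEuclideanLin_conjTranspose_eq_adjoint, LinearMap.adjoint_inner_left,
        ← Matrix.toEuclideanLin_conjTranspose_eq_adjoint, h0, inner_zero_right]
    exact Subtype.ext (inner_self_eq_zero.1 h1)
  refine ⟨hinj, (LinearMap.injective_iff_surjective_of_finrank_eq_finrank ?_).1 hinj⟩
  have e1 : Module.finrank ℝ (rangeAdj B) = B.conjTranspose.rank := by
    rw [rangeAdj, Matrix.toEuclideanLin_eq_toLin_orthonormal, ← Matrix.rank_eq_finrank_range_toLin]
  have e2 : Module.finrank ℝ (rangeMat B) = B.rank := by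
    rw [rangeMat, Matrix.toEuclideanLin_eq_toLin_orthonormal, ← Matrix.rank_eq_finrank_range_toLin]
  rw [e1, e2, Matrix.rank_conjTranspose]

/-- The operator `B⁽⁻¹⁾ : R₁ → R`, the inverse of the map `R → R₁` induced by `B`. -/
def invMap (B : Matrix n n ℝ) : rangeMat B →ₗ[ℝ] rangeAdj B :=
  (LinearEquiv.ofBijective (restrictedMap B) (restrictedMap_bijective B)).symm

/-- The operator `Λ = B⁽⁻¹⁾ A` on the range `R` of `B*`; here `A` is followed by the orthogonal
projection onto the range of `B`, where `B⁽⁻¹⁾` is defined (if `A B*` is self-adjoint, then `A`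
maps `R` to the range of `B` anyway). The norm is the Euclidean operator norm. -/
def vertexOperator (A B : Matrix n n ℝ) : rangeAdj B →L[ℝ] rangeAdj B :=
  LinearMap.toContinuousLinearMap
    (invMap B ∘ₗ (rangeMat B).orthogonalProjectionOnto.toLinearMap ∘ₗ Matrix.toEuclideanLin A ∘ₗ
      (rangeAdj B).subtype)

end Lambda

namespace MetricGraph

variable {V E : Type*} [Fintype E] [DecidableEq V] [DecidableEq E] (G : MetricGraph V E)

/-- `S = max_v ‖Λ_v‖`. -/
def maxVertexNorm (A B : ∀ v, Matrix (G.EdgeEnd v) (G.EdgeEnd v) ℝ) : ℝ :=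
  ⨆ v, ‖vertexOperator (A v) (B v)‖

/-- The bounds `κ₀² > 4 S / l_min` and `2 S l_max ≤ H₀`, where `l_min` and `l_max` are the smallest
and the largest edge length, and `H₀` is the minimum of `H`. -/
def LengthBounds (H : G.Point → ℝ) (κ₀ : ℝ)
    (A B : ∀ v, Matrix (G.EdgeEnd v) (G.EdgeEnd v) ℝ) : Prop :=
  4 * G.maxVertexNorm A B * (⨅ e, G.len e)⁻¹ < κ₀ ^ 2 ∧
    2 * G.maxVertexNorm A B * (⨆ e, G.len e) ≤ ⨅ p, H p

/-- Every `Λ_v` is non-positive. -/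
def NonposVertex (A B : ∀ v, Matrix (G.EdgeEnd v) (G.EdgeEnd v) ℝ) : Prop :=
  ∀ v, ∀ x : rangeAdj (B v), inner ℝ (vertexOperator (A v) (B v) x) x ≤ 0

end MetricGraph

/-- The linear operator `T` with domain `D(T)` is a bijection from `D(T)` onto the whole space,
and its inverse is a compact operator. -/
def HasCompactInverse {X : Type*} [NormedAddCommGroup X] [InnerProductSpace ℝ X]
    (T : X →ₗ.[ℝ] X) : Prop :=
  ∃ K : X →L[ℝ] X, IsCompactOperator K ∧
    (∀ f : X, ∃ h : K f ∈ T.domain, T ⟨K f, h⟩ = f) ∧ ∀ u : T.domain, K (T u) = u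

end

/-! ### Symmetric operators onto a Hilbert space -/

section SymmetricOperators

variable {X : Type*} [NormedAddCommGroup X] [InnerProductSpace ℝ X] [CompleteSpace X]

/-! The theorem is reduced to three facts about `L`: it is symmetric, it is positive definite, and
it has a compact right inverse defined on all of `L₂(Γ)`. A symmetric operator that is onto is
automatically densely defined and self-adjoint; positivity makes it injective, so the right inverse
is the inverse (`isSelfAdjoint_and_hasCompactInverse`).

Symmetry and positivity come from Green's formula (`inner_operator`): `(Lu, w)` is the sum of `(κ²u,
w)`, `(Hu', w')` and the vertex terms `y ⬝ᵥ x`, where `x` collects the values of `w` and `y` those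
of `Hu'`. With the factor `H(v)` absorbed in the flux, the condition at `v` reads `A x + B y = 0`.
The rank condition and `AB* = BA*` give its solutions as the vectors `(B* z, -A* z)`, so the vertex
terms are symmetric, and for `w = u` they equal `-⟨Λ x, x⟩`. If `Λ ≤ 0` they only help. Otherwise
they are at least `-S` times the sum of the squared end values, which the trace inequality
`sq_contRep_add_sq_contRep_le` bounds by `4 l⁻¹ ‖u‖² + 2 l ‖u'‖²` on each edge; the length bounds
let the `κ²` and `H` terms absorb this.

Surjectivity avoids quadratic forms. On each edge `-(Hu')' = g` is integrated twice from the initial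
data `u(0)` and `(Hu')(0)`. For the unknown consisting of `g` and these `2|E|` numbers, the equation
`Lu = f` and the `2|E|` vertex conditions form a system `z + C z = (f, 0)`. Here `C` is compact,
because the Volterra operator is compact and the remaining part has finite-dimensional range. By the
Fredholm alternative, injectivity of `L` suffices to solve it, and `u` depends compactly on `f`. -/

lemma LinearPMap.IsFormalAdjoint.dense_domain_of_surjective {T : X →ₗ.[ℝ] X}
    (hT : T.IsFormalAdjoint T)
    (hsurj : ∀ f, ∃ u : T.domain, T u = f) : Dense (T.domain : Set X) := by
  rw [Submodule.dense_iff_topologicalClosure_eq_top,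
    Submodule.topologicalClosure_eq_top_iff, Submodule.eq_bot_iff]
  intro f hf
  obtain ⟨w, rfl⟩ := hsurj f
  have hw : w = 0 := by
    -- With `f = T w` orthogonal to the domain and `w = T z`, symmetry gives `⟨w, w⟩ = ⟨w, T z⟩ = ⟨T
    -- w, z⟩ = 0`.
    obtain ⟨z, hz⟩ := hsurj (w : X)
    have h0 : inner ℝ (w : X) (T z) = 0 := by
      rw [← hT w z, real_inner_comm]
      exact (Submodule.mem_orthogonal _ _).1 hf z z.2
    rw [hz, inner_self_eq_zero] at h0
    exact Subtype.ext h0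
  rw [hw, LinearPMap.map_zero]

lemma LinearPMap.IsFormalAdjoint.isSelfAdjoint_of_surjective {T : X →ₗ.[ℝ] X}
    (hT : T.IsFormalAdjoint T) (hd : Dense (T.domain : Set X))
    (hsurj : ∀ f, ∃ u : T.domain, T u = f) : IsSelfAdjoint T := by
  have hle : T ≤ T.adjoint := hT.le_adjoint hd
  refine LinearPMap.isSelfAdjoint_def.2 (LinearPMap.eq_of_le_of_domain_eq hle ?_).symm
  refine le_antisymm hle.1 fun y hy => ?_
  -- Choose `w` in the domain with `T w = T* y`. Then `y - w` is orthogonal to the range of `T`,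
  -- which is the whole space.
  obtain ⟨w, hw⟩ := hsurj (T.adjoint ⟨y, hy⟩)
  suffices y = w by rw [this]; exact w.2
  rw [← sub_eq_zero]
  obtain ⟨z, hz⟩ := hsurj (y - w)
  have h1 := LinearPMap.adjoint_isFormalAdjoint hd ⟨y, hy⟩ z
  have h2 := hT w z
  rw [← hw, h2, ← sub_eq_zero, ← inner_sub_left, hz, ← neg_eq_zero, ← inner_neg_left,
    neg_sub, inner_self_eq_zero] at h1
  exact h1

/-- A symmetric, positive definite operator with a compact right inverse is densely defined,
self-adjoint, and has a compact inverse. -/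
lemma LinearPMap.IsFormalAdjoint.isSelfAdjoint_and_hasCompactInverse {T : X →ₗ.[ℝ] X}
    (hT : T.IsFormalAdjoint T) (hpos : ∀ u : T.domain, u ≠ 0 → 0 < inner ℝ (T u) (u : X))
    {K : X →L[ℝ] X} (hK : IsCompactOperator K) (hTK : ∀ f, ∃ h : K f ∈ T.domain, T ⟨K f, h⟩ = f) :
    Dense (T.domain : Set X) ∧ IsSelfAdjoint T ∧ HasCompactInverse T := by
  have hinj : ∀ u : T.domain, T u = 0 → u = 0 := fun u hu => by
    by_contra hne
    simpa [hu] using hpos u hne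
  have hsurj : ∀ f, ∃ u : T.domain, T u = f := fun f => ⟨⟨K f, (hTK f).1⟩, (hTK f).2⟩
  have hd := hT.dense_domain_of_surjective hsurj
  refine ⟨hd, hT.isSelfAdjoint_of_surjective hd hsurj, K, hK, hTK, fun u => ?_⟩
  obtain ⟨h, h'⟩ := hTK (T u)
  have := hinj (⟨K (T u), h⟩ - u) (by rw [LinearPMap.map_sub, h', sub_self])
  exact congrArg Subtype.val (sub_eq_zero.1 this)

end SymmetricOperators

/-! ### Compact operators -/

section Compact

/-- A product of compact sets is compact by Tychonoff; finiteness of the index set keeps the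
intersection of the preimages a neighbourhood of zero. -/
lemma IsCompactOperator.pi {ι M : Type*} [Finite ι] {N : ι → Type*} [Zero M] [TopologicalSpace M]
    [∀ i, TopologicalSpace (N i)] {f : M → ∀ i, N i}
    (hf : ∀ i, IsCompactOperator fun x => f x i) : IsCompactOperator f := by
  choose K hK hf using hf
  refine ⟨Set.pi univ K, isCompact_univ_pi hK, ?_⟩
  have : f ⁻¹' Set.pi univ K = ⋂ i, (fun x => f x i) ⁻¹' K i := by
    ext x; simp [Set.mem_pi]
  rw [this]
  exact Filter.iInter_mem.2 hf

lemma IsCompactOperator.prodMk {M N N' : Type*} [Zero M] [TopologicalSpace M]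
    [TopologicalSpace N] [TopologicalSpace N'] {f : M → N} {g : M → N'}
    (hf : IsCompactOperator f) (hg : IsCompactOperator g) :
    IsCompactOperator fun x => (f x, g x) := by
  obtain ⟨K, hK, hf⟩ := hf
  obtain ⟨K', hK', hg⟩ := hg
  exact ⟨K ×ˢ K', hK.prod hK', Filter.inter_mem hf hg⟩

/-- If a compact perturbation of the identity is injective, then it is invertible. -/
lemma IsCompactOperator.exists_rightInverse_of_injective {X : Type*} [NormedAddCommGroup X]
    [NormedSpace ℝ X] [CompleteSpace X] {C : X →L[ℝ] X} (hC : IsCompactOperator C)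
    (hinj : ∀ x, x + C x = 0 → x = 0) : ∃ N : X →L[ℝ] X, ∀ x, N x + C (N x) = x := by
  have hr : (-1 : ℝ) ∈ resolventSet ℝ C := by
    -- Fredholm alternative: the nonzero number `-1` is either an eigenvalue of `C`, which
    -- injectivity excludes, or in the resolvent set.
    refine (hC.hasEigenvalue_or_mem_resolventSet (by norm_num)).resolve_left fun h => ?_
    obtain ⟨x, hx⟩ := h.exists_hasEigenvector
    refine hx.2 (hinj x ?_)
    have := hx.apply_eq_smul
    simp only [ContinuousLinearMap.coe_coe] at this
    rw [this]; simp
  rw [spectrum.mem_resolventSet_iff] at hr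
  obtain ⟨N, -, hN⟩ := hr.exists_right_inv.imp fun N h => And.intro trivial h
  refine ⟨-N, fun x => ?_⟩
  have := congrArg (fun T : X →L[ℝ] X => T x) hN
  simpa [Algebra.algebraMap_eq_smul_one, sub_eq_add_neg] using this

end Compact

/-! ### Vertex conditions -/

section VertexCondition

variable {n : Type*} [Fintype n] {A B : Matrix n n ℝ}

lemma mul_transpose_comm_of_isHermitian (hAB : (A * B.conjTranspose).IsHermitian) :
    A * B.transpose = B * A.transpose := by
  have := hAB.eq
  simp only [Matrix.conjTranspose_eq_transpose_of_trivial, Matrix.transpose_mul,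
    Matrix.transpose_transpose] at this
  exact this.symm

/-- The solutions of `A x + B y = 0` are the vectors `(B* z, -A* z)`. -/
lemma exists_transpose_mulVec_of_mulVec_add_eq_zero
    (hrank : (Matrix.fromCols A B).rank = Fintype.card n) (hAB : (A * B.conjTranspose).IsHermitian)
    {x y : n → ℝ} (hxy : A.mulVec x + B.mulVec y = 0) :
    ∃ z : n → ℝ, x = B.transpose.mulVec z ∧ y = -A.transpose.mulVec z := by
  have hAB' := mul_transpose_comm_of_isHermitian hAB
  let P := (Matrix.fromCols A B).mulVecLin
  let Q := (Matrix.fromCols B (-A)).transpose.mulVecLin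
  -- This inclusion is the identity `AB* = BA*`; the rest of the proof shows that both spaces have
  -- dimension `n`.
  have hle : LinearMap.range Q ≤ LinearMap.ker P := by
    rintro _ ⟨z, rfl⟩
    change (Matrix.fromCols A B).mulVec ((Matrix.fromCols B (-A)).transpose.mulVec z) = 0
    rw [Matrix.transpose_fromCols, Matrix.fromRows_mulVec, Matrix.fromCols_mulVec_sumElim,
      Matrix.mulVec_mulVec, Matrix.mulVec_mulVec, hAB', Matrix.transpose_neg, Matrix.mul_neg,
      Matrix.neg_mulVec, add_neg_cancel]
  have hrank' : (Matrix.fromCols B (-A)).transpose.rank = Fintype.card n := by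
    let P' := (Matrix.fromCols A B).transpose.mulVecLin
    -- Both kernels are the common kernel of `A*` and `B*`, so `(B, -A)` inherits full rank from
    -- `(A, B)`.
    have hker : LinearMap.ker Q = LinearMap.ker P' := by
      ext z
      simp only [Q, P', LinearMap.mem_ker, Matrix.mulVecLin_apply, Matrix.transpose_fromCols,
        Matrix.fromRows_mulVec, Matrix.transpose_neg, Matrix.neg_mulVec, funext_iff, Sum.forall,
        Sum.elim_inl, Sum.elim_inr, Pi.zero_apply, Pi.neg_apply, neg_eq_zero]
      exact and_comm
    have h1 := Q.finrank_range_add_finrank_ker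
    have h2 := P'.finrank_range_add_finrank_ker
    have h3 : Module.finrank ℝ (LinearMap.range P') = Fintype.card n :=
      (Matrix.rank_transpose _).trans hrank
    change Module.finrank ℝ (LinearMap.range Q) = _
    rw [hker] at h1
    omega
  have hfin : Module.finrank ℝ (LinearMap.ker P) = Module.finrank ℝ (LinearMap.range Q) := by
    have h1 := P.finrank_range_add_finrank_ker
    have h2 : Module.finrank ℝ (LinearMap.range P) = Fintype.card n := hrank
    have h3 : Module.finrank ℝ (LinearMap.range Q) = Fintype.card n := hrank'
    simp at h1
    omega
  have hmem : Sum.elim x y ∈ LinearMap.ker P := by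
    simp [P, hxy]
  rw [← Submodule.eq_of_le_of_finrank_eq hle hfin.symm] at hmem
  obtain ⟨z, hz⟩ := hmem
  simp only [Q, Matrix.mulVecLin_apply, Matrix.transpose_fromCols, Matrix.fromRows_mulVec,
    Matrix.transpose_neg, Matrix.neg_mulVec] at hz
  exact ⟨z, funext fun i => (congrFun hz (Sum.inl i)).symm,
    funext fun i => (congrFun hz (Sum.inr i)).symm⟩

/-- Under the vertex conditions the boundary form `⟨y, x'⟩` is symmetric. -/
lemma dotProduct_comm_of_vertexCondition
    (hrank : (Matrix.fromCols A B).rank = Fintype.card n) (hAB : (A * B.conjTranspose).IsHermitian)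
    {x y x' y' : n → ℝ} (hxy : A.mulVec x + B.mulVec y = 0)
    (hxy' : A.mulVec x' + B.mulVec y' = 0) : y ⬝ᵥ x' = x ⬝ᵥ y' := by
  obtain ⟨z, rfl, rfl⟩ := exists_transpose_mulVec_of_mulVec_add_eq_zero hrank hAB hxy
  obtain ⟨z', rfl, rfl⟩ := exists_transpose_mulVec_of_mulVec_add_eq_zero hrank hAB hxy'
  have hAB' := mul_transpose_comm_of_isHermitian hAB
  rw [neg_dotProduct, dotProduct_neg, neg_inj, Matrix.mulVec_transpose,
    ← Matrix.dotProduct_mulVec, Matrix.mulVec_mulVec, hAB', Matrix.mulVec_transpose B,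
    ← Matrix.dotProduct_mulVec, Matrix.mulVec_mulVec]

variable [DecidableEq n]

/-- Under the vertex conditions the boundary form is `-⟨Λ x, x⟩`. -/
lemma exists_inner_vertexOperator_eq
    (hrank : (Matrix.fromCols A B).rank = Fintype.card n) (hAB : (A * B.conjTranspose).IsHermitian)
    {x y : n → ℝ} (hxy : A.mulVec x + B.mulVec y = 0) :
    ∃ r : rangeAdj B, (r : EuclideanSpace ℝ n) = WithLp.toLp 2 x ∧
      inner ℝ (vertexOperator A B r) r = -(y ⬝ᵥ x) := by
  obtain ⟨z, rfl, rfl⟩ := exists_transpose_mulVec_of_mulVec_add_eq_zero hrank hAB hxy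
  have hAB' := mul_transpose_comm_of_isHermitian hAB
  have hr : WithLp.toLp 2 (B.transpose.mulVec z) ∈ rangeAdj B :=
    ⟨WithLp.toLp 2 z, by simp [Matrix.conjTranspose_eq_transpose_of_trivial]⟩
  refine ⟨⟨_, hr⟩, rfl, ?_⟩
  set r : rangeAdj B := ⟨_, hr⟩
  -- `A B* z = B A* z` lies in the range of `B`, so the projection in the definition of `Λ` acts
  -- trivially and `B Λ r = A r`. Hence `⟨Λ r, B* z⟩ = ⟨A r, z⟩ = ⟨r, A* z⟩`, and `A* z = -y`.
  have hmem : Matrix.toEuclideanLin A r ∈ rangeMat B :=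
    ⟨WithLp.toLp 2 (A.transpose.mulVec z), by simp [r, hAB']⟩
  have h1 : restrictedMap B (vertexOperator A B r) = ⟨Matrix.toEuclideanLin A r, hmem⟩ := by
    have : (rangeMat B).orthogonalProjectionOnto (Matrix.toEuclideanLin A r) =
        ⟨Matrix.toEuclideanLin A r, hmem⟩ :=
      (rangeMat B).orthogonalProjectionOnto_mem_subspace_eq_self ⟨_, hmem⟩
    rw [← this]
    exact LinearEquiv.apply_symm_apply
      (LinearEquiv.ofBijective (restrictedMap B) (restrictedMap_bijective B)) _
  have h2 : Matrix.toEuclideanLin B (vertexOperator A B r : EuclideanSpace ℝ n) =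
      Matrix.toEuclideanLin A r := congrArg Subtype.val h1
  rw [Submodule.coe_inner, EuclideanSpace.inner_eq_star_dotProduct]
  generalize (vertexOperator A B r : EuclideanSpace ℝ n) = w at h2
  have h3 : B.mulVec w.ofLp = (B * A.transpose).mulVec z := by
    have := congrArg WithLp.ofLp h2
    simpa [r, hAB'] using this
  change B.transpose.mulVec z ⬝ᵥ star w.ofLp = _
  rw [star_trivial, neg_dotProduct, neg_neg, Matrix.mulVec_transpose, ← Matrix.dotProduct_mulVec,
    h3, dotProduct_comm, ← hAB', ← Matrix.mulVec_mulVec, dotProduct_comm,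
    Matrix.dotProduct_mulVec, ← Matrix.mulVec_transpose, ← Matrix.mulVec_transpose]

end VertexCondition

/-! ### Primitives on a bounded interval -/

section Primitive

variable {l : ℝ}

lemma integral_intervalMeasure_eq (hl : 0 < l) (f : ℝ → ℝ) :
    ∫ x, f x ∂(intervalMeasure l) = ∫ x in (0 : ℝ)..l, f x := by
  rw [intervalIntegral.integral_of_le hl.le, integral_Ioc_eq_integral_Ioo]

/-- The characteristic function of `(a, b]` as an element of `L₂(0, l)`. -/
noncomputable def indicatorInterval (l a b : ℝ) : L2Interval l :=
  indicatorConstLp 2 (measurableSet_Ioc : MeasurableSet (Ioc a b)) (measure_ne_top _ _) 1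

/-- Integration over `[a, b]` as a bounded linear functional on `L₂(0, l)`. -/
noncomputable def integralInterval (l a b : ℝ) : L2Interval l →L[ℝ] ℝ :=
  innerSL ℝ (indicatorInterval l a b)

lemma integralInterval_apply {a b : ℝ} (ha : 0 ≤ a) (hab : a ≤ b) (hb : b ≤ l)
    (g : L2Interval l) : integralInterval l a b g = ∫ x in a..b, g x := by
  have hs : Ioc a b ⊆ Icc 0 l := fun x hx => ⟨ha.trans hx.1.le, hx.2.trans hb⟩
  have h : (intervalMeasure l).restrict (Ioc a b) = volume.restrict (Ioc a b) := by
    -- When `b = l`, the set `(a, b]` is not contained in the open interval; passing to the closed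
    -- one changes only a null set.
    rw [show intervalMeasure l = volume.restrict (Icc 0 l) from restrict_Ioo_eq_restrict_Icc,
      Measure.restrict_restrict measurableSet_Ioc,
      inter_eq_left.2 hs]
  rw [integralInterval, innerSL_apply_apply, indicatorInterval, L2.inner_indicatorConstLp_one,
    intervalIntegral.integral_of_le hab, h]

lemma norm_indicatorInterval_le {a b : ℝ} (hab : a ≤ b) :
    ‖indicatorInterval l a b‖ ≤ √(b - a) := by
  refine norm_indicatorConstLp_le.trans ?_
  rw [norm_one, one_mul, ENNReal.toReal_ofNat, ← Real.sqrt_eq_rpow]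
  refine Real.sqrt_le_sqrt ?_
  have : (intervalMeasure l).real (Ioc a b) ≤ volume.real (Ioc a b) :=
    ENNReal.toReal_mono (by simp) (Measure.restrict_apply_le _ _)
  rwa [Real.volume_real_Ioc_of_le hab] at this

lemma abs_intervalIntegral_le {a b : ℝ} (ha : 0 ≤ a) (hab : a ≤ b) (hb : b ≤ l)
    (g : L2Interval l) : |∫ x in a..b, g x| ≤ √(b - a) * ‖g‖ := by
  rw [← integralInterval_apply ha hab hb, integralInterval, innerSL_apply_apply]
  exact (abs_real_inner_le_norm _ _).trans
    (mul_le_mul_of_nonneg_right (norm_indicatorInterval_le hab) (norm_nonneg _))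

lemma L2Interval.intervalIntegrable {a b : ℝ} (ha : a ∈ Icc 0 l) (hb : b ∈ Icc 0 l)
    (g : L2Interval l) : IntervalIntegrable g volume a b := by
  have : IntervalIntegrable g volume 0 l :=
    (intervalIntegrable_iff_integrableOn_Ioo_of_le (ha.1.trans ha.2)).2 g.integrableOn
  refine this.mono_set ?_
  rw [uIcc_of_le (ha.1.trans ha.2)]
  exact uIcc_subset_Icc ha hb

lemma memLp_intervalMeasure_of_continuousOn {f : ℝ → ℝ} (hf : ContinuousOn f (Icc 0 l)) :
    MemLp f 2 (intervalMeasure l) := by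
  obtain ⟨C, hC⟩ := isCompact_Icc.exists_bound_of_continuousOn hf
  refine MemLp.of_bound ((hf.mono Ioo_subset_Icc_self).aestronglyMeasurable measurableSet_Ioo) C ?_
  filter_upwards [ae_restrict_mem measurableSet_Ioo] with x hx
  exact hC x (Ioo_subset_Icc_self hx)

lemma continuousOn_primitive_L2 (hl : 0 < l) (g : L2Interval l) :
    ContinuousOn (fun x => ∫ t in (0 : ℝ)..x, g t) (Icc 0 l) := by
  have := (ac_primitive hl g.integrableOn 0).1.continuousOn
  rw [uIcc_of_le hl.le] at this
  simpa using this

lemma norm_le_of_ae_bound_intervalMeasure (hl : 0 < l) {u : L2Interval l} {C : ℝ} (hC : 0 ≤ C)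
    (h : ∀ᵐ x ∂(intervalMeasure l), |u x| ≤ C) : ‖u‖ ≤ √l * C := by
  refine (Lp.norm_le_of_ae_bound hC h).trans_eq ?_
  congr 1
  have : ((measureUnivNNReal (intervalMeasure l) : ℝ≥0) : ℝ) = l := by
    simp [measureUnivNNReal, ENNReal.coe_toNNReal_eq_toReal, hl.le]
  rw [this, ENNReal.toReal_ofNat, Real.sqrt_eq_rpow]
  norm_num

/-- The Volterra operator `g ↦ ∫₀ˣ g` in `L₂(0, l)`. -/
noncomputable def primitiveL (hl : 0 < l) : L2Interval l →L[ℝ] L2Interval l :=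
  LinearMap.mkContinuous
    { toFun := fun g => (memLp_intervalMeasure_of_continuousOn
        (continuousOn_primitive_L2 hl g)).toLp _
      map_add' := fun g k => by
        rw [← MemLp.toLp_add]
        refine MemLp.toLp_congr _ _ ?_
        filter_upwards [ae_restrict_mem measurableSet_Ioo] with x hx
        have h0 : (0 : ℝ) ∈ Icc 0 l := ⟨le_rfl, hl.le⟩
        have hx' := Ioo_subset_Icc_self hx
        rw [Pi.add_apply, ← intervalIntegral.integral_add (g.intervalIntegrable h0 hx')
          (k.intervalIntegrable h0 hx'), ← integralInterval_apply le_rfl hx.1.le hx.2.le,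
          map_add, integralInterval_apply le_rfl hx.1.le hx.2.le,
          integralInterval_apply le_rfl hx.1.le hx.2.le,
          intervalIntegral.integral_add (g.intervalIntegrable h0 hx')
          (k.intervalIntegrable h0 hx')]
      map_smul' := fun c g => by
        rw [RingHom.id_apply, ← MemLp.toLp_const_smul]
        refine MemLp.toLp_congr _ _ ?_
        filter_upwards [ae_restrict_mem measurableSet_Ioo] with x hx
        rw [Pi.smul_apply, ← integralInterval_apply le_rfl hx.1.le hx.2.le,
          ← integralInterval_apply le_rfl hx.1.le hx.2.le, map_smul] }
    (√l * √l) fun g => by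
      rw [mul_assoc]
      refine norm_le_of_ae_bound_intervalMeasure hl (by positivity) ?_
      filter_upwards [(memLp_intervalMeasure_of_continuousOn
        (continuousOn_primitive_L2 hl g)).coeFn_toLp, ae_restrict_mem measurableSet_Ioo] with x h hx
      simp only [LinearMap.coe_mk, AddHom.coe_mk]
      rw [h]
      refine (abs_intervalIntegral_le le_rfl hx.1.le hx.2.le g).trans ?_
      have : √(x - 0) ≤ √l := Real.sqrt_le_sqrt (by linarith [hx.2])
      exact mul_le_mul_of_nonneg_right this (norm_nonneg _)

lemma coeFn_primitiveL (hl : 0 < l) (g : L2Interval l) :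
    primitiveL hl g =ᵐ[intervalMeasure l] fun x => ∫ t in (0 : ℝ)..x, g t :=
  (memLp_intervalMeasure_of_continuousOn (continuousOn_primitive_L2 hl g)).coeFn_toLp

/-- The constant functions in `L₂(0, l)`. -/
noncomputable abbrev constInterval (l : ℝ) : ℝ →L[ℝ] L2Interval l :=
  Lp.constL 2 (intervalMeasure l) ℝ

lemma coeFn_const_add_primitiveL (hl : 0 < l) (c : ℝ) (g : L2Interval l) :
    (constInterval l c + primitiveL hl g : L2Interval l) =ᵐ[intervalMeasure l]
      fun x => c + ∫ t in (0 : ℝ)..x, g t := by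
  filter_upwards [Lp.coeFn_add (constInterval l c) (primitiveL hl g), coeFn_primitiveL hl g,
    Lp.coeFn_const 2 (intervalMeasure l) c] with x h1 h2 h3
  rw [h1, Pi.add_apply, h2, Lp.constL_apply, h3, Function.const_apply]

lemma isContRep_const_add_primitiveL (hl : 0 < l) (c : ℝ) (g : L2Interval l) :
    IsContRep (constInterval l c + primitiveL hl g : L2Interval l)
      fun x => c + ∫ t in (0 : ℝ)..x, g t :=
  ⟨continuousOn_const.add (continuousOn_primitive_L2 hl g), coeFn_const_add_primitiveL hl c g⟩

lemma hasWeakDeriv_const_add_primitiveL (hl : 0 < l) (c : ℝ) (g : L2Interval l) :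
    HasWeakDeriv l (constInterval l c + primitiveL hl g : L2Interval l) g := by
  obtain ⟨h1, h2⟩ := ac_primitive hl g.integrableOn c
  exact (hasWeakDeriv_of_ac hl h1).congr (coeFn_const_add_primitiveL hl c g).symm h2

lemma const_add_primitiveL_mem_H1 (hl : 0 < l) (c : ℝ) (g : L2Interval l) :
    constInterval l c + primitiveL hl g ∈ H1Interval l :=
  ⟨g, hasWeakDeriv_const_add_primitiveL hl c g⟩

lemma contRep_const_add_primitiveL (hl : 0 < l) (c : ℝ) (g : L2Interval l) {x : ℝ}
    (hx : x ∈ Icc 0 l) :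
    contRep (constInterval l c + primitiveL hl g) x = c + ∫ t in (0 : ℝ)..x, g t :=
  (isContRep_contRep hl (const_add_primitiveL_mem_H1 hl c g)).eqOn hl
    (isContRep_const_add_primitiveL hl c g) hx

lemma weakDeriv_const_add_primitiveL (hl : 0 < l) (c : ℝ) (g : L2Interval l) :
    weakDeriv (constInterval l c + primitiveL hl g) = g :=
  weakDeriv_eq (hasWeakDeriv_const_add_primitiveL hl c g)

/-- Every `u ∈ H¹(0, l)` is the primitive of its weak derivative. -/
lemma eq_const_add_primitiveL (hl : 0 < l) {u : L2Interval l} (hu : u ∈ H1Interval l) :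
    u = constInterval l (contRep u 0) + primitiveL hl (weakDeriv u) := by
  obtain ⟨c, hc⟩ := (weakDeriv_spec hu).exists_primitive hl u.integrableOn
    (weakDeriv u).integrableOn
  have h : u = constInterval l c + primitiveL hl (weakDeriv u) :=
    Lp.ext (hc.trans (coeFn_const_add_primitiveL hl c _).symm)
  have h0 : contRep u 0 = c := by
    rw [h, contRep_const_add_primitiveL hl c _ ⟨le_rfl, hl.le⟩]
    simp
  rw [h0]
  exact h

lemma contRep_eq_add_integral (hl : 0 < l) {u : L2Interval l} (hu : u ∈ H1Interval l) {x : ℝ}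
    (hx : x ∈ Icc 0 l) : contRep u x = contRep u 0 + ∫ t in (0 : ℝ)..x, weakDeriv u t := by
  conv_lhs => rw [eq_const_add_primitiveL hl hu]
  exact contRep_const_add_primitiveL hl _ _ hx

lemma contRep_sub_contRep (hl : 0 < l) {u : L2Interval l} (hu : u ∈ H1Interval l) {x y : ℝ}
    (hx : x ∈ Icc 0 l) (hy : y ∈ Icc 0 l) :
    contRep u y - contRep u x = ∫ t in x..y, weakDeriv u t := by
  have h0 : (0 : ℝ) ∈ Icc 0 l := ⟨le_rfl, hl.le⟩
  rw [contRep_eq_add_integral hl hu hx, contRep_eq_add_integral hl hu hy, add_sub_add_left_eq_sub,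
    intervalIntegral.integral_interval_sub_left ((weakDeriv u).intervalIntegrable h0 hy)
      ((weakDeriv u).intervalIntegrable h0 hx)]

/-- Integration by parts. -/
lemma inner_weakDeriv_left (hl : 0 < l) {p w : L2Interval l} (hp : p ∈ H1Interval l)
    (hw : w ∈ H1Interval l) :
    inner ℝ (weakDeriv p) w =
      contRep p l * contRep w l - contRep p 0 * contRep w 0 - inner ℝ p (weakDeriv w) := by
  have hac := fun (u : L2Interval l) => ac_primitive hl (weakDeriv u).integrableOn (contRep u 0)
  have hae : ∀ u ∈ H1Interval l, u =ᵐ[intervalMeasure l]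
      fun x => contRep u 0 + ∫ t in (0 : ℝ)..x, weakDeriv u t := fun u hu => by
    conv_lhs => rw [eq_const_add_primitiveL hl hu]
    exact coeFn_const_add_primitiveL hl _ _
  -- Both functions are replaced by their absolutely continuous primitives, for which the classical
  -- formula holds.
  have key := (hac p).1.integral_mul_deriv_eq_deriv_mul (hac w).1
  have hll : l ∈ Icc 0 l := ⟨hl.le, le_rfl⟩
  simp only [← contRep_eq_add_integral hl hp hll, ← contRep_eq_add_integral hl hw hll,
    intervalIntegral.integral_same, add_zero] at key
  rw [← integral_intervalMeasure_eq hl, ← integral_intervalMeasure_eq hl] at key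
  have e1 : inner ℝ p (weakDeriv w) = ∫ x, (contRep p 0 + ∫ t in (0 : ℝ)..x, weakDeriv p t) *
      deriv (fun x => contRep w 0 + ∫ t in (0 : ℝ)..x, weakDeriv w t) x
        ∂(intervalMeasure l) := by
    rw [L2.inner_def]
    refine integral_congr_ae ?_
    filter_upwards [hae p hp, (hac w).2] with x h1 h2
    rw [h2, ← h1]
    simp [mul_comm]
  have e2 : inner ℝ (weakDeriv p) w = ∫ x,
      deriv (fun x => contRep p 0 + ∫ t in (0 : ℝ)..x, weakDeriv p t) x *
        (contRep w 0 + ∫ t in (0 : ℝ)..x, weakDeriv w t) ∂(intervalMeasure l) := by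
    rw [L2.inner_def]
    refine integral_congr_ae ?_
    filter_upwards [hae w hw, (hac p).2] with x h1 h2
    rw [h2, ← h1]
    simp [mul_comm]
  rw [e1, e2, key]
  ring

/-- The trace inequality for the two end points. -/
lemma sq_contRep_add_sq_contRep_le (hl : 0 < l) {u : L2Interval l} (hu : u ∈ H1Interval l) :
    contRep u 0 ^ 2 + contRep u l ^ 2 ≤ 4 * l⁻¹ * ‖u‖ ^ 2 + 2 * l * ‖weakDeriv u‖ ^ 2 := by
  have h0 : (0 : ℝ) ∈ Icc 0 l := ⟨le_rfl, hl.le⟩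
  have hll : l ∈ Icc 0 l := ⟨hl.le, le_rfl⟩
  set N := ‖weakDeriv u‖
  have hsq : ∀ x y : ℝ, 0 ≤ x → x ≤ y → y ≤ l →
      (∫ t in x..y, weakDeriv u t) ^ 2 ≤ (y - x) * N ^ 2 := fun x y hx hxy hy => by
    rw [← sq_abs]
    calc _ ≤ (√(y - x) * N) ^ 2 := by
          gcongr
          exact abs_intervalIntegral_le hx hxy hy _
      _ = _ := by rw [mul_pow, Real.sq_sqrt (by linarith)]
  -- `u(0)² ≤ 2u(x)² + 2(u(x) - u(0))²`, and likewise at `l`. By Cauchy–Schwarz the squared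
  -- increments are at most `x N²` and `(l - x) N²`, whose sum is `l N²`. Integrating in `x` then
  -- gives `l` times the claim.
  have hpt : ∀ᵐ x ∂(intervalMeasure l),
      contRep u 0 ^ 2 + contRep u l ^ 2 ≤ 4 * (u x * u x) + 2 * l * N ^ 2 := by
    filter_upwards [(isContRep_contRep hl hu).2, ae_restrict_mem measurableSet_Ioo] with x hx hx'
    have hxm := Ioo_subset_Icc_self hx'
    have e1 := hsq 0 x le_rfl hx'.1.le hx'.2.le
    have e2 := hsq x l hx'.1.le hx'.2.le le_rfl
    rw [← contRep_sub_contRep hl hu h0 hxm] at e1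
    rw [← contRep_sub_contRep hl hu hxm hll] at e2
    rw [hx]
    nlinarith [sq_nonneg (2 * contRep u x - contRep u 0), sq_nonneg (2 * contRep u x - contRep u l)]
  have hi : Integrable (fun x => u x * u x) (intervalMeasure l) :=
    (Lp.memLp u).integrable_mul (Lp.memLp u)
  have hint := integral_mono_ae (integrable_const _) ((hi.const_mul 4).add (integrable_const _)) hpt
  have hn : ∫ x, u x * u x ∂(intervalMeasure l) = ‖u‖ ^ 2 := by
    rw [← real_inner_self_eq_norm_sq, L2.inner_def]
    simp [sq]
  simp only [Pi.add_apply] at hint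
  rw [integral_add (hi.const_mul 4) (integrable_const _), integral_const_mul, hn] at hint
  simp only [integral_const, smul_eq_mul, measureReal_restrict_apply_univ,
    Real.volume_real_Ioo_of_le hl.le, sub_zero] at hint
  rw [← mul_le_mul_iff_of_pos_left hl]
  refine hint.trans_eq ?_
  field_simp

end Primitive

/-! ### Compactness of the Volterra operator -/

section Volterra

variable {l : ℝ}

/-- A step function approximation of the Volterra operator, with `n` steps of equal length. -/
noncomputable def primitiveStep (l : ℝ) (n : ℕ) : L2Interval l →L[ℝ] L2Interval l :=
  ∑ k ∈ Finset.range n, (integralInterval l 0 (k * (l / n))).smulRight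
    (indicatorInterval l (k * (l / n)) ((k + 1) * (l / n)))

lemma isCompactOperator_finsetSum {ι M N : Type*} [NormedAddCommGroup M] [NormedSpace ℝ M]
    [NormedAddCommGroup N] [NormedSpace ℝ N] (s : Finset ι) {f : ι → M →L[ℝ] N}
    (hf : ∀ i ∈ s, IsCompactOperator (f i)) : IsCompactOperator (∑ i ∈ s, f i : M →L[ℝ] N) :=
  (compactOperator (RingHom.id ℝ) M N).sum_mem hf

lemma isCompactOperator_smulRight {M N : Type*} [NormedAddCommGroup M] [NormedSpace ℝ M]
    [NormedAddCommGroup N] [NormedSpace ℝ N] (f : M →L[ℝ] ℝ) (x : N) :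
    IsCompactOperator (f.smulRight x) :=
  (isCompactOperator_of_locallyCompactSpace_dom f).clm_comp
    (ContinuousLinearMap.toSpanSingleton ℝ x)

lemma isCompactOperator_primitiveStep (n : ℕ) : IsCompactOperator (primitiveStep l n) :=
  isCompactOperator_finsetSum _ fun _ _ => isCompactOperator_smulRight _ _

/-- On the step `(kd, (k+1)d]`, with `d = l / n`, the approximation stops the integral at `kd`. The
pointwise error is an integral over length at most `d`, hence at most `√d ‖g‖`; the factor `√l`
comes from the total mass. -/
lemma norm_primitiveL_sub_primitiveStep_le (hl : 0 < l) {n : ℕ} (hn : 0 < n) :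
    ‖primitiveL hl - primitiveStep l n‖ ≤ √l * √(l / n) := by
  set d := l / n with hd
  have hn' : (0 : ℝ) < n := by exact_mod_cast hn
  have hdp : 0 < d := by positivity
  have hnd : n * d = l := by rw [hd]; field_simp
  refine ContinuousLinearMap.opNorm_le_bound _ (by positivity) fun g => ?_
  rw [mul_assoc]
  refine norm_le_of_ae_bound_intervalMeasure hl (by positivity) ?_
  have hstep : primitiveStep l n g = ∑ k ∈ Finset.range n, integralInterval l 0 (k * d) g •
      indicatorInterval l (k * d) ((k + 1) * d) := by
    simp [primitiveStep, hd]
  have hind : ∀ k ∈ Finset.range n, ∀ᵐ x ∂(intervalMeasure l),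
      (integralInterval l 0 (k * d) g • indicatorInterval l (k * d) ((k + 1) * d) : L2Interval l) x
        = integralInterval l 0 (k * d) g *
          (Ioc (k * d) ((k + 1) * d)).indicator (fun _ => (1 : ℝ)) x := fun k _ => by
    filter_upwards [Lp.coeFn_smul (integralInterval l 0 (k * d) g)
      (indicatorInterval l (k * d) ((k + 1) * d)), indicatorConstLp_coeFn (p := 2)
        (hs := (measurableSet_Ioc : MeasurableSet (Ioc (k * d) ((k + 1) * d))))
        (hμs := measure_ne_top (intervalMeasure l) _) (c := (1 : ℝ))] with x h1 h2
    rw [h1, Pi.smul_apply, smul_eq_mul, indicatorInterval, h2]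
  have hind' := (Filter.eventually_all_finset _).2 hind
  have hsub := Lp.coeFn_sub (primitiveL hl g) (primitiveStep l n g)
  have hsum := Lp.coeFn_fun_finsetSum (Finset.range n) fun k : ℕ =>
    (integralInterval l 0 (k * d) g • indicatorInterval l (k * d) ((k + 1) * d) : L2Interval l)
  rw [← hstep] at hsum
  filter_upwards [hind', hsub, hsum, coeFn_primitiveL hl g, ae_restrict_mem measurableSet_Ioo]
    with x h1 h2 h3 h4 hx
  rw [sub_apply, h2, Pi.sub_apply, h3, h4, Finset.sum_congr rfl h1]
  -- The steps are open on the left, so `k + 1` is the ceiling of `x / d`; it is positive since `x >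
  -- 0`, so the subtraction of `1` is exact.
  obtain ⟨k, hk, hk'⟩ : ∃ k : ℕ, (k : ℝ) * d < x ∧ x ≤ (k + 1) * d := by
    have hxd : 0 < x / d := div_pos hx.1 hdp
    have hpos : 0 < ⌈x / d⌉₊ := Nat.ceil_pos.2 hxd
    refine ⟨⌈x / d⌉₊ - 1, ?_, ?_⟩
    · rw [← lt_div_iff₀ hdp]
      exact Nat.lt_ceil.1 (Nat.sub_lt hpos one_pos)
    · rw [← div_le_iff₀ hdp, Nat.cast_sub hpos, Nat.cast_one, sub_add_cancel]
      exact Nat.le_ceil _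
  have hkn : k < n := by
    have : (k : ℝ) * d < n * d := by rw [hnd]; exact hk.trans hx.2
    exact_mod_cast lt_of_mul_lt_mul_right this hdp.le
  rw [Finset.sum_eq_single_of_mem k (Finset.mem_range.2 hkn) fun j _ hj => ?_]
  · have hkx : x ∈ Ioc (k * d) ((k + 1) * d) := ⟨hk, hk'⟩
    have hk0 : (0 : ℝ) ≤ k * d := by positivity
    have hxl := hx.2.le
    rw [indicator_of_mem hkx, mul_one, integralInterval_apply le_rfl hk0 (hk.le.trans hxl),
      intervalIntegral.integral_interval_sub_left
        (g.intervalIntegrable ⟨le_rfl, hl.le⟩ ⟨hx.1.le, hxl⟩)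
        (g.intervalIntegrable ⟨le_rfl, hl.le⟩ ⟨hk0, hk.le.trans hxl⟩)]
    refine (abs_intervalIntegral_le hk0 hk.le hxl g).trans ?_
    have : √(x - k * d) ≤ √d := Real.sqrt_le_sqrt (by linarith)
    exact mul_le_mul_of_nonneg_right this (norm_nonneg _)
  · rw [indicator_of_notMem, mul_zero]
    rintro ⟨hj1, hj2⟩
    have a1 : (j : ℝ) < k + 1 := lt_of_mul_lt_mul_right (hj1.trans_le hk') hdp.le
    have a2 : (k : ℝ) < j + 1 := lt_of_mul_lt_mul_right (hk.trans_le hj2) hdp.le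
    have b1 : j < k + 1 := by exact_mod_cast a1
    have b2 : k < j + 1 := by exact_mod_cast a2
    omega

/-- The Volterra operator is the norm limit of the finite-rank step approximations. -/
lemma isCompactOperator_primitiveL (hl : 0 < l) : IsCompactOperator (primitiveL hl) := by
  refine isCompactOperator_of_tendsto (l := Filter.atTop) (F := primitiveStep l) ?_
    (Filter.Eventually.of_forall isCompactOperator_primitiveStep)
  rw [tendsto_iff_norm_sub_tendsto_zero]
  have hlim : Filter.Tendsto (fun n : ℕ => √l * √(l / n)) Filter.atTop (nhds 0) := by
    have := ((tendsto_const_div_atTop_nhds_zero_nat l).sqrt).const_mul √l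
    simpa using this
  refine squeeze_zero' (Filter.Eventually.of_forall fun _ => norm_nonneg _) ?_ hlim
  filter_upwards [Filter.eventually_gt_atTop 0] with n hn
  rw [norm_sub_rev]
  exact norm_primitiveL_sub_primitiveStep_le hl hn

end Volterra

/-! ### Multiplication operators -/

section Multiplication

variable {l : ℝ}

/-- Multiplication by a bounded function as an operator in `L₂(0, l)`. -/
noncomputable def mulL (a : Lp ℝ ∞ (intervalMeasure l)) : L2Interval l →L[ℝ] L2Interval l :=
  LinearMap.mkContinuous
    { toFun := fun u => a • u
      map_add' := fun u w => Lp.add_smul a u w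
      map_smul' := fun c u => (Lp.smul_comm c a u).symm }
    ‖a‖ fun u => Lp.norm_smul_le a u

lemma inner_lpSMul_left (a : Lp ℝ ∞ (intervalMeasure l)) (u w : L2Interval l) :
    inner ℝ (a • u : L2Interval l) w = inner ℝ u (a • w : L2Interval l) := by
  rw [L2.inner_def, L2.inner_def]
  refine integral_congr_ae ?_
  filter_upwards [Lp.coeFn_lpSMul (r := 2) a u, Lp.coeFn_lpSMul (r := 2) a w] with x h1 h2
  rw [h1, h2]
  simp only [Pi.smul_apply', smul_eq_mul, RCLike.inner_apply, conj_trivial]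
  ring

lemma mul_norm_sq_le_inner_lpSMul {a : Lp ℝ ∞ (intervalMeasure l)} {m : ℝ}
    (ha : ∀ᵐ x ∂(intervalMeasure l), m ≤ a x) (u : L2Interval l) :
    m * ‖u‖ ^ 2 ≤ inner ℝ (a • u : L2Interval l) u := by
  rw [← real_inner_self_eq_norm_sq, ← real_inner_smul_left, L2.inner_def, L2.inner_def]
  refine integral_mono_ae (L2.integrable_inner _ _) (L2.integrable_inner _ _) ?_
  filter_upwards [ha, Lp.coeFn_lpSMul (r := 2) a u, Lp.coeFn_smul m u] with x h1 h2 h3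
  rw [h2, h3]
  simp only [Pi.smul_apply', Pi.smul_apply, smul_eq_mul, RCLike.inner_apply, conj_trivial]
  nlinarith [mul_self_nonneg (u x)]

/-- The right-hand side is `‖a u‖²`, and Cauchy–Schwarz turns `m ‖u‖² ≤ (a u, u)` into `m ‖u‖ ≤ ‖a
u‖`. -/
lemma sq_mul_norm_sq_le_inner_lpSMul {a : Lp ℝ ∞ (intervalMeasure l)} {m : ℝ} (hm : 0 ≤ m)
    (ha : ∀ᵐ x ∂(intervalMeasure l), m ≤ a x) (u : L2Interval l) :
    m ^ 2 * ‖u‖ ^ 2 ≤ inner ℝ (a • (a • u : L2Interval l) : L2Interval l) u := by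
  rw [inner_lpSMul_left, real_inner_self_eq_norm_sq, ← mul_pow]
  refine pow_le_pow_left₀ (by positivity) ?_ 2
  rcases (norm_nonneg u).eq_or_lt with h0 | h0
  · rw [← h0, mul_zero]
    exact norm_nonneg _
  · have h := (mul_norm_sq_le_inner_lpSMul ha u).trans (real_inner_le_norm _ _)
    rw [sq, ← mul_assoc] at h
    exact le_of_mul_le_mul_right h h0

lemma lipschitz_toLp_coeFn {h : ℝ → ℝ} (hh : ∃ K : ℝ≥0, LipschitzWith K h) (u : L2Interval l) :
    ((memLp_of_lipschitz (l := l) hh).toLp h • u : L2Interval l) =ᵐ[intervalMeasure l]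
      fun x => h x * u x := by
  filter_upwards [Lp.coeFn_lpSMul (r := 2) ((memLp_of_lipschitz (l := l) hh).toLp h) u,
    (memLp_of_lipschitz (l := l) hh).coeFn_toLp] with x h1 h2
  rw [h1, Pi.smul_apply', h2, smul_eq_mul]

lemma contRep_lipschitz_smul (hl : 0 < l) {h : ℝ → ℝ} (hh : ∃ K : ℝ≥0, LipschitzWith K h)
    {u : L2Interval l} (hu : u ∈ H1Interval l) {x : ℝ} (hx : x ∈ Icc 0 l) :
    contRep ((memLp_of_lipschitz (l := l) hh).toLp h • u : L2Interval l) x =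
      h x * contRep u x := by
  have h1 := isContRep_contRep hl hu
  obtain ⟨K, hK⟩ := id hh
  have h2 : IsContRep ((memLp_of_lipschitz (l := l) hh).toLp h • u : L2Interval l)
      fun x => h x * contRep u x := by
    refine ⟨hK.continuous.continuousOn.mul h1.1, ?_⟩
    filter_upwards [lipschitz_toLp_coeFn hh u, h1.2] with x h3 h4
    rw [h3, h4]
  exact (isContRep_contRep hl (lipschitz_smul_mem_H1 hl hh hu)).eqOn hl h2 hx

lemma lipschitz_smul_smul_cancel {h k : ℝ → ℝ} (hh : ∃ K : ℝ≥0, LipschitzWith K h)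
    (hk : ∃ K : ℝ≥0, LipschitzWith K k) (hhk : ∀ x, h x * k x = 1) (u : L2Interval l) :
    ((memLp_of_lipschitz (l := l) hh).toLp h •
      ((memLp_of_lipschitz (l := l) hk).toLp k • u : L2Interval l) : L2Interval l) = u := by
  apply Lp.ext
  filter_upwards [lipschitz_toLp_coeFn hh
    ((memLp_of_lipschitz (l := l) hk).toLp k • u : L2Interval l),
    lipschitz_toLp_coeFn hk u] with x h1 h2
  rw [h1, h2, ← mul_assoc, hhk, one_mul]

/-- `|1/a - 1/b| = |b - a| / (ab)`, so `K / m²` is a Lipschitz constant. -/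
lemma exists_lipschitzWith_inv {h : ℝ → ℝ} (hh : ∃ K : ℝ≥0, LipschitzWith K h) {m : ℝ}
    (hm : 0 < m) (hmh : ∀ x, m ≤ h x) : ∃ K : ℝ≥0, LipschitzWith K fun x => (h x)⁻¹ := by
  obtain ⟨K, hK⟩ := hh
  refine ⟨K * (m.toNNReal⁻¹ ^ 2), LipschitzWith.of_dist_le_mul fun x y => ?_⟩
  have hx := hm.trans_le (hmh x)
  have hy := hm.trans_le (hmh y)
  have hK' := hK.dist_le_mul y x
  rw [Real.dist_eq] at hK' ⊢
  rw [inv_sub_inv hx.ne' hy.ne', abs_div, abs_of_pos (mul_pos hx hy), dist_comm]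
  push_cast
  rw [Real.coe_toNNReal _ hm.le, inv_pow, ← div_eq_mul_inv, div_mul_eq_mul_div]
  refine div_le_div₀ (by positivity) hK' (by positivity) ?_
  rw [sq]
  exact mul_le_mul (hmh x) (hmh y) hm.le hx.le

end Multiplication

/-! ### The operator on the graph -/

namespace MetricGraph

variable {V E : Type*} (G : MetricGraph V E) {H : G.Point → ℝ}

/-! ### The coefficient `H` on the edges, and sums over edge ends. -/

lemma exists_pos_le_edge (hHpos : ∀ p, 0 < H p) (hHlip : ∃ K : ℝ≥0, LipschitzWith K H) (e : E) :
    ∃ m, 0 < m ∧ ∀ x, m ≤ H (G.edgePoint e x) := by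
  obtain ⟨K, hK⟩ := G.lipschitz_edge hHlip e
  obtain ⟨x₀, -, hx₀⟩ := isCompact_Icc.exists_isMinOn (nonempty_Icc.2 (G.len_pos e).le)
    hK.continuous.continuousOn
  refine ⟨_, hHpos (G.edgePoint e x₀), fun x => ?_⟩
  have h := hx₀ (projIcc 0 (G.len e) (G.len_pos e).le x).2
  have hx : G.edgePoint e (projIcc 0 (G.len e) (G.len_pos e).le x : ℝ) = G.edgePoint e x := by
    rw [edgePoint, edgePoint, projIcc_val]
  simpa only [mem_ofPred_eq, hx] using h

lemma lipschitz_edge_inv (hHpos : ∀ p, 0 < H p) (hHlip : ∃ K : ℝ≥0, LipschitzWith K H) (e : E) :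
    ∃ K : ℝ≥0, LipschitzWith K fun x => (H (G.edgePoint e x))⁻¹ := by
  obtain ⟨m, hm, hmH⟩ := G.exists_pos_le_edge hHpos hHlip e
  exact exists_lipschitzWith_inv (G.lipschitz_edge hHlip e) hm hmH

/-- The function `1 / H`, restricted to the edge `e`, as an element of `L∞(e)`. -/
noncomputable def edgeCoeffInv (hHpos : ∀ p, 0 < H p) (hHlip : ∃ K : ℝ≥0, LipschitzWith K H)
    (e : E) : Lp ℝ ∞ (intervalMeasure (G.len e)) :=
  (memLp_of_lipschitz (G.lipschitz_edge_inv hHpos hHlip e)).toLp _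

lemma edgeCoeff_smul_edgeCoeffInv_smul (hHpos : ∀ p, 0 < H p)
    (hHlip : ∃ K : ℝ≥0, LipschitzWith K H) (e : E) (u : L2Interval (G.len e)) :
    (G.edgeCoeff hHlip e • (G.edgeCoeffInv hHpos hHlip e • u : L2Interval (G.len e)) :
      L2Interval (G.len e)) = u :=
  lipschitz_smul_smul_cancel (G.lipschitz_edge hHlip e)
    (G.lipschitz_edge_inv hHpos hHlip e) (fun x => mul_inv_cancel₀ (hHpos (G.edgePoint e x)).ne') u

lemma vertexPoint_eq_edgePoint (e : E) (b : Bool) :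
    G.vertexPoint (G.endpoint e b) = G.edgePoint e (G.endCoord e b) := by
  have h := Quot.sound (Glue.mk (G := G) e b)
  rw [vertexPoint, ← h, edgePoint, projIcc_of_mem _ (G.endCoord_mem e b)]

/-- Every edge end sits at exactly one vertex, so the edge ends at the vertices partition `E ×
Bool`; a loop contributes both its ends to one vertex. -/
lemma sum_sum_edgeEnd [Fintype V] [DecidableEq V] [Fintype E] (f : E × Bool → ℝ) :
    ∑ v, ∑ h : G.EdgeEnd v, f h.1 = ∑ e, (f (e, false) + f (e, true)) := by
  have h1 := (Equiv.sigmaFiberEquiv fun p : E × Bool => G.endpoint p.1 p.2).sum_comp f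
  rw [Fintype.sum_sigma, Fintype.sum_prod_type] at h1
  refine h1.trans (Finset.sum_congr rfl fun e _ => ?_)
  rw [Fintype.sum_bool, add_comm]

/-! #### Green's formula -/

variable {G}

/-- The vector of the values of `H u'` at `v`, directed away from `v`, along the edge ends
at `v`. -/
noncomputable def boundaryFlux (hHlip : ∃ K : ℝ≥0, LipschitzWith K H) (u : G.L2) (v : V) :
    G.EdgeEnd v → ℝ :=
  fun h => (if h.1.2 then -1 else 1) *
    contRep (G.edgeCoeff hHlip h.1.1 • weakDeriv (u h.1.1) : L2Interval (G.len h.1.1))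
      (G.endCoord h.1.1 h.1.2)

/-- `H(v)` is the common end value of `H` along all edges at `v`. Hence the factor `H(v)` disappears
from the vertex condition once it is written with the flux `H u'`. -/
lemma smul_boundaryDeriv (hHlip : ∃ K : ℝ≥0, LipschitzWith K H) {u : G.L2}
    (hu : ∀ e, u e ∈ H2Interval (G.len e)) (v : V) :
    H (G.vertexPoint v) • boundaryDeriv u v = boundaryFlux hHlip u v := by
  ext ⟨⟨e, b⟩, rfl⟩
  simp only [boundaryFlux, boundaryDeriv, Pi.smul_apply, smul_eq_mul, edgeCoeff]
  rw [contRep_lipschitz_smul (G.len_pos e) (G.lipschitz_edge hHlip e) (hu e).2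
    (G.endCoord_mem e b), G.vertexPoint_eq_edgePoint]
  ring

lemma mem_operatorDomain_iff [Fintype E] [DecidableEq V]
    (hHlip : ∃ K : ℝ≥0, LipschitzWith K H) {A B : ∀ v, Matrix (G.EdgeEnd v) (G.EdgeEnd v) ℝ}
    {u : G.L2} : u ∈ G.operatorDomain H A B ↔ (∀ e, u e ∈ H2Interval (G.len e)) ∧
      ∀ v, (A v).mulVec (boundaryValue u v) + (B v).mulVec (boundaryFlux hHlip u v) = 0 := by
  refine and_congr_right fun hu => forall_congr' fun v => ?_
  rw [← smul_boundaryDeriv hHlip hu, Matrix.mulVec_smul]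

lemma ae_le_edgeCoeff (hHlip : ∃ K : ℝ≥0, LipschitzWith K H) {m : ℝ} (hm : ∀ p, m ≤ H p) (e : E) :
    ∀ᵐ x ∂(intervalMeasure (G.len e)), m ≤ G.edgeCoeff hHlip e x := by
  filter_upwards [(memLp_of_lipschitz (G.lipschitz_edge hHlip e)).coeFn_toLp] with x hx
  rw [edgeCoeff, hx]
  exact hm _

lemma neg_norm_mul_sum_sq_le_boundary [Fintype E] [DecidableEq V] [DecidableEq E]
    {v : V} {A B : Matrix (G.EdgeEnd v) (G.EdgeEnd v) ℝ}
    (hrank : (Matrix.fromCols A B).rank = Fintype.card (G.EdgeEnd v))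
    (hAB : (A * B.conjTranspose).IsHermitian) {x y : G.EdgeEnd v → ℝ}
    (hxy : A.mulVec x + B.mulVec y = 0) :
    -(‖vertexOperator A B‖ * ∑ h, x h ^ 2) ≤ y ⬝ᵥ x := by
  obtain ⟨r, hr, hr'⟩ := exists_inner_vertexOperator_eq hrank hAB hxy
  have h1 : ‖r‖ ^ 2 = ∑ h, x h ^ 2 := by
    rw [Submodule.coe_norm, hr, EuclideanSpace.real_norm_sq_eq]
  rw [← h1, neg_le, ← hr', sq, ← mul_assoc]
  exact (real_inner_le_norm _ _).trans
    (mul_le_mul_of_nonneg_right (ContinuousLinearMap.le_opNorm _ _) (norm_nonneg _))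

lemma edgeCoeff_smul_mem_H1 (hHlip : ∃ K : ℝ≥0, LipschitzWith K H) {e : E}
    {u : L2Interval (G.len e)} (hu : u ∈ H1Interval (G.len e)) :
    (G.edgeCoeff hHlip e • u : L2Interval (G.len e)) ∈ H1Interval (G.len e) :=
  lipschitz_smul_mem_H1 (G.len_pos e) (G.lipschitz_edge hHlip e) hu

variable [Fintype V] [Fintype E] [DecidableEq V]

/-- Green's formula: integration by parts on each edge, with the end terms regrouped by vertices.
The sign of the derivative directed away from the vertex matches the sign of the end term. -/
lemma inner_operator (hHlip : ∃ K : ℝ≥0, LipschitzWith K H) {κ : G.LInfty}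
    {A B : ∀ v, Matrix (G.EdgeEnd v) (G.EdgeEnd v) ℝ}
    (u : (G.operator H hHlip κ A B).domain) {w : G.L2} (hw : ∀ e, w e ∈ H2Interval (G.len e)) :
    inner ℝ (G.operator H hHlip κ A B u) w =
      (∑ e, (inner ℝ (κ e • (κ e • u.1 e : L2Interval (G.len e)) : L2Interval (G.len e)) (w e) +
        inner ℝ (G.edgeCoeff hHlip e • weakDeriv (u.1 e) : L2Interval (G.len e))
          (weakDeriv (w e)))) +
      ∑ v, boundaryFlux hHlip u.1 v ⬝ᵥ boundaryValue w v := by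
  have hu := ((mem_operatorDomain_iff hHlip).1 u.2).1
  have hsum : ∑ v, boundaryFlux hHlip u.1 v ⬝ᵥ boundaryValue w v = _ :=
    G.sum_sum_edgeEnd fun p : E × Bool => ((if p.2 then -1 else 1) *
      contRep (G.edgeCoeff hHlip p.1 • weakDeriv (u.1 p.1) : L2Interval (G.len p.1))
        (G.endCoord p.1 p.2)) * contRep (w p.1) (G.endCoord p.1 p.2)
  rw [hsum, PiLp.inner_apply, ← Finset.sum_add_distrib]
  refine Finset.sum_congr rfl fun e _ => ?_
  change inner ℝ ((κ e • (κ e • u.1 e : L2Interval (G.len e)) : L2Interval (G.len e)) -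
    weakDeriv (G.edgeCoeff hHlip e • weakDeriv (u.1 e) : L2Interval (G.len e))) (w e) = _
  rw [inner_sub_left, inner_weakDeriv_left (G.len_pos e)
    (edgeCoeff_smul_mem_H1 hHlip (hu e).2) (hw e).1]
  simp only [endCoord, if_true, Bool.false_eq_true, if_false]
  ring

lemma isFormalAdjoint_operator (hHlip : ∃ K : ℝ≥0, LipschitzWith K H) {κ : G.LInfty}
    {A B : ∀ v, Matrix (G.EdgeEnd v) (G.EdgeEnd v) ℝ} [DecidableEq E]
    (hrank : ∀ v, (Matrix.fromCols (A v) (B v)).rank = Fintype.card (G.EdgeEnd v))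
    (hAB : ∀ v, (A v * (B v).conjTranspose).IsHermitian) :
    (G.operator H hHlip κ A B).IsFormalAdjoint (G.operator H hHlip κ A B) := by
  intro u w
  have hu := (mem_operatorDomain_iff hHlip).1 u.2
  have hw := (mem_operatorDomain_iff hHlip).1 w.2
  rw [real_inner_comm (G.operator H hHlip κ A B w), inner_operator hHlip u hw.1,
    inner_operator hHlip w hu.1]
  congr 1
  · refine Finset.sum_congr rfl fun e _ => ?_
    rw [inner_lpSMul_left, inner_lpSMul_left, inner_lpSMul_left, real_inner_comm,
      real_inner_comm (weakDeriv (u.1 e))]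
  · refine Finset.sum_congr rfl fun v _ => ?_
    rw [dotProduct_comm_of_vertexCondition (hrank v) (hAB v) (hu.2 v) (hw.2 v), dotProduct_comm]

/-! #### Positivity -/

variable [DecidableEq E]

/-- Under the length bounds the `H` term dominates the derivative part of the trace inequality, and
the `κ²` term strictly dominates the rest. If all `Λ_v` are non-positive, the vertex terms are
non-negative and `κ₀² ‖u‖²` is already a lower bound. -/
lemma inner_operator_pos (hHpos : ∀ p, 0 < H p) (hHlip : ∃ K : ℝ≥0, LipschitzWith K H)
    {κ : G.LInfty} {κ₀ : ℝ} (hκ₀ : 0 < κ₀)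
    (hκ : ∀ e, ∀ᵐ x ∂(intervalMeasure (G.len e)), κ₀ ≤ κ e x)
    {A B : ∀ v, Matrix (G.EdgeEnd v) (G.EdgeEnd v) ℝ}
    (hrank : ∀ v, (Matrix.fromCols (A v) (B v)).rank = Fintype.card (G.EdgeEnd v))
    (hAB : ∀ v, (A v * (B v).conjTranspose).IsHermitian)
    (hass : G.LengthBounds H κ₀ A B ∨ G.NonposVertex A B)
    (u : (G.operator H hHlip κ A B).domain) (hu0 : u ≠ 0) :
    0 < inner ℝ (G.operator H hHlip κ A B u) (u : G.L2) := by
  obtain ⟨hu, hbd⟩ := (mem_operatorDomain_iff hHlip).1 u.2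
  have hun : 0 < ∑ e, ‖u.1 e‖ ^ 2 := by
    rw [← PiLp.norm_sq_eq_of_L2]
    have : 0 < ‖u.1‖ := norm_pos_iff.2 fun h => hu0 (Subtype.ext h)
    positivity
  have hκu := fun e => sq_mul_norm_sq_le_inner_lpSMul hκ₀.le (hκ e) (u.1 e)
  rw [inner_operator hHlip u hu]
  rcases hass with ⟨hκS, hHS⟩ | hΛ
  · set S := G.maxVertexNorm A B with hS
    have hS0 : 0 ≤ S := Real.iSup_nonneg fun v => ContinuousLinearMap.opNorm_nonneg _
    have hvert : -(S * ∑ e, (contRep (u.1 e) 0 ^ 2 + contRep (u.1 e) (G.len e) ^ 2)) ≤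
        ∑ v, boundaryFlux hHlip u.1 v ⬝ᵥ boundaryValue u.1 v := by
      have h1 := G.sum_sum_edgeEnd fun p : E × Bool =>
        contRep (u.1 p.1) (G.endCoord p.1 p.2) ^ 2
      simp only [endCoord, if_true, Bool.false_eq_true, if_false] at h1
      rw [← h1, Finset.mul_sum, ← Finset.sum_neg_distrib]
      refine Finset.sum_le_sum fun v _ => le_trans (neg_le_neg ?_)
        (neg_norm_mul_sum_sq_le_boundary (hrank v) (hAB v) (hbd v))
      exact mul_le_mul_of_nonneg_right
        (le_ciSup (f := fun v => ‖vertexOperator (A v) (B v)‖) (Finite.bddAbove_range _) v)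
        (Finset.sum_nonneg fun _ _ => sq_nonneg _)
    have hedge : ∀ e, (κ₀ ^ 2 - 4 * S * (⨅ e, G.len e)⁻¹) * ‖u.1 e‖ ^ 2 ≤
        inner ℝ (κ e • (κ e • u.1 e : L2Interval (G.len e)) : L2Interval (G.len e)) (u.1 e) +
        inner ℝ (G.edgeCoeff hHlip e • weakDeriv (u.1 e) : L2Interval (G.len e))
          (weakDeriv (u.1 e)) -
        S * (contRep (u.1 e) 0 ^ 2 + contRep (u.1 e) (G.len e) ^ 2) := fun e => by
      have : Nonempty E := ⟨e⟩
      have hmin : 0 < ⨅ e, G.len e := by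
        obtain ⟨e', he'⟩ := exists_eq_ciInf_of_finite (f := G.len)
        rw [← he']
        exact G.len_pos e'
      have hl1 : (G.len e)⁻¹ ≤ (⨅ e, G.len e)⁻¹ :=
        inv_anti₀ hmin (ciInf_le (Finite.bddBelow_range _) e)
      have hl2 : G.len e ≤ ⨆ e, G.len e := le_ciSup (Finite.bddAbove_range G.len) e
      -- Positivity of `H` supplies the lower bound that makes the real infimum of `H` a genuine
      -- one.
      have hH0 : ∀ p, 2 * S * (⨆ e, G.len e) ≤ H p := fun p =>
        hHS.trans (ciInf_le ⟨0, by rintro _ ⟨q, rfl⟩; exact (hHpos q).le⟩ p)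
      have h1 := mul_norm_sq_le_inner_lpSMul (ae_le_edgeCoeff hHlip hH0 e) (weakDeriv (u.1 e))
      have h2 := mul_le_mul_of_nonneg_left
        (sq_contRep_add_sq_contRep_le (G.len_pos e) (hu e).1) hS0
      have h3 := mul_le_mul_of_nonneg_left hl1 (by positivity : 0 ≤ 4 * S * ‖u.1 e‖ ^ 2)
      have h4 := mul_le_mul_of_nonneg_left hl2 (by positivity : 0 ≤ 2 * S * ‖weakDeriv (u.1 e)‖ ^ 2)
      linarith [hκu e]
    have htot := Finset.sum_le_sum fun e (_ : e ∈ Finset.univ) => hedge e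
    rw [← Finset.mul_sum, Finset.sum_sub_distrib, ← Finset.mul_sum] at htot
    have := mul_pos (sub_pos.2 hκS) hun
    linarith
  · have hvert : 0 ≤ ∑ v, boundaryFlux hHlip u.1 v ⬝ᵥ boundaryValue u.1 v :=
      Finset.sum_nonneg fun v _ => by
        obtain ⟨r, -, hr⟩ := exists_inner_vertexOperator_eq (hrank v) (hAB v) (hbd v)
        linarith [hΛ v r]
    have hedge : ∀ e, κ₀ ^ 2 * ‖u.1 e‖ ^ 2 ≤
        inner ℝ (κ e • (κ e • u.1 e : L2Interval (G.len e)) : L2Interval (G.len e)) (u.1 e) +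
        inner ℝ (G.edgeCoeff hHlip e • weakDeriv (u.1 e) : L2Interval (G.len e))
          (weakDeriv (u.1 e)) := fun e => by
      have h1 := mul_norm_sq_le_inner_lpSMul (ae_le_edgeCoeff hHlip (fun p => (hHpos p).le) e)
        (weakDeriv (u.1 e))
      linarith [hκu e]
    have htot := Finset.sum_le_sum fun e (_ : e ∈ Finset.univ) => hedge e
    rw [← Finset.mul_sum] at htot
    have := mul_pos (pow_pos hκ₀ 2) hun
    linarith

end MetricGraph

namespace MetricGraph

/-! #### Reduction of the boundary value problem to a compact perturbation of the identity -/

variable {V E : Type*} {G : MetricGraph V E} {H : G.Point → ℝ}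

variable (G) in
/-- The right-hand sides `g` of `-(H u')' = g`, together with the initial data `u(0)` (with
index `(e, false)`) and `(H u')(0)` (with index `(e, true)`) on the edges. -/
abbrev CauchyData : Type _ := G.L2 × (E × Bool → ℝ)

/-- The component on the edge `e` of the right-hand side. -/
noncomputable def dataRhs (e : E) : G.CauchyData →L[ℝ] L2Interval (G.len e) :=
  PiLp.proj 2 (fun e : E => L2Interval (G.len e)) e ∘L ContinuousLinearMap.fst ℝ _ _

/-- The initial value with a given index. -/
noncomputable def dataInit (p : E × Bool) : G.CauchyData →L[ℝ] ℝ :=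
  ContinuousLinearMap.proj p ∘L ContinuousLinearMap.snd ℝ _ _

/-- The function `H u'` on the edge `e`, where `u` solves `-(H u')' = g`. -/
noncomputable def edgeFlux (e : E) : G.CauchyData →L[ℝ] L2Interval (G.len e) :=
  constInterval (G.len e) ∘L dataInit (e, true) - primitiveL (G.len_pos e) ∘L dataRhs e

/-- The solution `u` of `-(H u')' = g` on the edge `e`. -/
noncomputable def edgeSolution (hHpos : ∀ p, 0 < H p) (hHlip : ∃ K : ℝ≥0, LipschitzWith K H)
    (e : E) : G.CauchyData →L[ℝ] L2Interval (G.len e) :=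
  constInterval (G.len e) ∘L dataInit (e, false) +
    primitiveL (G.len_pos e) ∘L mulL (G.edgeCoeffInv hHpos hHlip e) ∘L edgeFlux e

/-- The value of `H u'` at an end of an edge. -/
noncomputable def endFlux (p : E × Bool) : G.CauchyData →L[ℝ] ℝ :=
  dataInit (p.1, true) - integralInterval (G.len p.1) 0 (G.endCoord p.1 p.2) ∘L dataRhs p.1

/-- The value of `u` at an end of an edge. -/
noncomputable def endValue (hHpos : ∀ p, 0 < H p) (hHlip : ∃ K : ℝ≥0, LipschitzWith K H)
    (p : E × Bool) : G.CauchyData →L[ℝ] ℝ :=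
  dataInit (p.1, false) + integralInterval (G.len p.1) 0 (G.endCoord p.1 p.2) ∘L
    mulL (G.edgeCoeffInv hHpos hHlip p.1) ∘L edgeFlux p.1

/-- The solution `u` of `-(H u')' = g` on the graph. -/
noncomputable def graphSolution (hHpos : ∀ p, 0 < H p) (hHlip : ∃ K : ℝ≥0, LipschitzWith K H) :
    G.CauchyData →L[ℝ] G.L2 :=
  (PiLp.continuousLinearEquiv 2 ℝ fun e : E => L2Interval (G.len e)).symm.toContinuousLinearMap ∘L
    ContinuousLinearMap.pi (edgeSolution hHpos hHlip)

/-- The form "constant plus primitive" to which the formulas for traces and weak derivatives apply.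
-/
lemma edgeFlux_eq (e : E) (z : G.CauchyData) : edgeFlux e z =
    constInterval (G.len e) (dataInit (e, true) z) + primitiveL (G.len_pos e) (-dataRhs e z) := by
  rw [map_neg, ← sub_eq_add_neg]
  rfl

variable (hHpos : ∀ p, 0 < H p) (hHlip : ∃ K : ℝ≥0, LipschitzWith K H)

lemma graphSolution_apply (z : G.CauchyData) (e : E) : graphSolution hHpos hHlip z e =
    constInterval (G.len e) (dataInit (e, false) z) + primitiveL (G.len_pos e)
      (G.edgeCoeffInv hHpos hHlip e • edgeFlux e z : L2Interval (G.len e)) :=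
  rfl

lemma edgeFlux_mem_H1 (z : G.CauchyData) (e : E) : edgeFlux e z ∈ H1Interval (G.len e) := by
  rw [edgeFlux_eq]
  exact const_add_primitiveL_mem_H1 _ _ _

lemma weakDeriv_edgeFlux (z : G.CauchyData) (e : E) :
    weakDeriv (edgeFlux e z) = -dataRhs e z := by
  rw [edgeFlux_eq, weakDeriv_const_add_primitiveL]

lemma weakDeriv_graphSolution (z : G.CauchyData) (e : E) :
    weakDeriv (graphSolution hHpos hHlip z e) =
      (G.edgeCoeffInv hHpos hHlip e • edgeFlux e z : L2Interval (G.len e)) := by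
  rw [graphSolution_apply, weakDeriv_const_add_primitiveL]

lemma graphSolution_mem_H2 (z : G.CauchyData) (e : E) :
    graphSolution hHpos hHlip z e ∈ H2Interval (G.len e) := by
  refine ⟨const_add_primitiveL_mem_H1 (G.len_pos e) _ _, ?_⟩
  rw [weakDeriv_graphSolution]
  exact lipschitz_smul_mem_H1 (G.len_pos e) (G.lipschitz_edge_inv hHpos hHlip e)
    (edgeFlux_mem_H1 z e)

lemma edgeCoeff_smul_weakDeriv_graphSolution (z : G.CauchyData) (e : E) :
    (G.edgeCoeff hHlip e • weakDeriv (graphSolution hHpos hHlip z e) : L2Interval (G.len e)) =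
      edgeFlux e z := by
  rw [weakDeriv_graphSolution, edgeCoeff_smul_edgeCoeffInv_smul]

lemma contRep_edgeFlux (z : G.CauchyData) (p : E × Bool) :
    contRep (edgeFlux p.1 z) (G.endCoord p.1 p.2) = endFlux p z := by
  obtain ⟨h0, hl⟩ := G.endCoord_mem p.1 p.2
  rw [edgeFlux_eq, contRep_const_add_primitiveL _ _ _ ⟨h0, hl⟩,
    ← integralInterval_apply le_rfl h0 hl, map_neg, ← sub_eq_add_neg]
  rfl

lemma contRep_graphSolution (z : G.CauchyData) (p : E × Bool) :
    contRep (graphSolution hHpos hHlip z p.1) (G.endCoord p.1 p.2) =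
      endValue hHpos hHlip p z := by
  obtain ⟨h0, hl⟩ := G.endCoord_mem p.1 p.2
  rw [graphSolution_apply, contRep_const_add_primitiveL _ _ _ ⟨h0, hl⟩,
    ← integralInterval_apply le_rfl h0 hl]
  rfl

/-- On each edge the solution is a rank-one term plus a bounded operator followed by the Volterra
operator. -/
lemma isCompactOperator_graphSolution [Finite E] :
    IsCompactOperator (graphSolution hHpos hHlip) := by
  have h : IsCompactOperator (ContinuousLinearMap.pi (edgeSolution hHpos hHlip)) := by
    refine IsCompactOperator.pi fun e => ?_
    exact ((isCompactOperator_of_locallyCompactSpace_dom (dataInit (e, false))).clm_comp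
      (constInterval (G.len e))).add ((isCompactOperator_primitiveL (G.len_pos e)).comp_clm
      (mulL (G.edgeCoeffInv hHpos hHlip e) ∘L edgeFlux e))
  exact h.clm_comp (PiLp.continuousLinearEquiv 2 ℝ
    fun e : E => L2Interval (G.len e)).symm.toContinuousLinearMap

/-- The initial data are determined by the solution. -/
lemma eq_zero_of_graphSolution_eq_zero {z : G.CauchyData} (hz : graphSolution hHpos hHlip z = 0) :
    z = 0 := by
  have hzero : ∀ l : ℝ, 0 < l → weakDeriv (0 : L2Interval l) = 0 ∧
      contRep (0 : L2Interval l) 0 = 0 := fun l hl => by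
    have h1 := weakDeriv_smul (0 : ℝ) (zero_mem (H1Interval l))
    have h2 := contRep_smul hl 0 (zero_mem (H1Interval l)) (x := 0) ⟨le_rfl, hl.le⟩
    rw [zero_smul, zero_smul] at h1
    rw [zero_smul, zero_mul] at h2
    exact ⟨h1, h2⟩
  -- From `u = 0` the flux `H u'` vanishes, hence so does `g = -(H u')'`. The initial data are the
  -- values of `u` and `H u'` at coordinate `0`, the end with index `false`.
  have hflux : ∀ e, edgeFlux e z = 0 := fun e => by
    rw [← edgeCoeff_smul_weakDeriv_graphSolution hHpos hHlip, hz, PiLp.zero_apply,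
      (hzero _ (G.len_pos e)).1, Lp.smul_zero]
  have hint : ∀ (l : ℝ) (hl : 0 < l) (g : L2Interval l), integralInterval l 0 0 g = 0 :=
    fun l hl g => by
      rw [integralInterval_apply le_rfl le_rfl hl.le, intervalIntegral.integral_same]
  refine Prod.ext (PiLp.ext fun e => ?_) (funext ?_)
  · have := weakDeriv_edgeFlux z e
    rw [hflux, (hzero _ (G.len_pos e)).1, zero_eq_neg] at this
    exact this
  · rintro ⟨e, b⟩
    cases b
    · have := contRep_graphSolution hHpos hHlip z (e, false)
      rw [hz, PiLp.zero_apply] at this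
      simp only [endCoord, Bool.false_eq_true, if_false, (hzero _ (G.len_pos e)).2, endValue,
        add_apply, ContinuousLinearMap.comp_apply, hint _ (G.len_pos e), add_zero] at this
      exact this.symm
    · have := contRep_edgeFlux z (e, false)
      rw [hflux] at this
      simp only [endCoord, Bool.false_eq_true, if_false, (hzero _ (G.len_pos e)).2, endFlux,
        sub_apply, ContinuousLinearMap.comp_apply, hint _ (G.len_pos e), sub_zero] at this
      exact this.symm

/-! ### The vertex conditions and the equation in terms of the Cauchy data. -/

variable [Fintype E] [DecidableEq V]

/-- The left-hand sides of the vertex conditions. -/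
noncomputable def vertexResidual (A B : ∀ v, Matrix (G.EdgeEnd v) (G.EdgeEnd v) ℝ) :
    G.CauchyData →L[ℝ] (E × Bool → ℝ) :=
  ContinuousLinearMap.pi fun p => ∑ q : G.EdgeEnd (G.endpoint p.1 p.2),
    (A _ ⟨p, rfl⟩ q • endValue hHpos hHlip q.1 +
      (B _ ⟨p, rfl⟩ q * (if q.1.2 then -1 else 1)) • endFlux q.1)

/-- The residual at the edge end `p` is the row with index `p` of the condition at the vertex of
`p`. So there are as many scalar conditions as initial data, and both live in `E × Bool → ℝ`. -/
lemma graphSolution_mem_operatorDomain_iff {A B : ∀ v, Matrix (G.EdgeEnd v) (G.EdgeEnd v) ℝ}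
    (z : G.CauchyData) : graphSolution hHpos hHlip z ∈ G.operatorDomain H A B ↔
      vertexResidual hHpos hHlip A B z = 0 := by
  rw [mem_operatorDomain_iff hHlip]
  have hval : ∀ v, boundaryValue (graphSolution hHpos hHlip z) v =
      fun h => endValue hHpos hHlip h.1 z :=
    fun v => funext fun h => contRep_graphSolution hHpos hHlip z h.1
  have hflux : ∀ v, boundaryFlux hHlip (graphSolution hHpos hHlip z) v =
      fun h => (if h.1.2 then -1 else 1) * endFlux h.1 z := fun v => funext fun h => by
    rw [boundaryFlux, edgeCoeff_smul_weakDeriv_graphSolution, contRep_edgeFlux]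
  have hres : ∀ p : E × Bool, vertexResidual hHpos hHlip A B z p =
      ((A (G.endpoint p.1 p.2)).mulVec (boundaryValue (graphSolution hHpos hHlip z) _) +
        (B (G.endpoint p.1 p.2)).mulVec
          (boundaryFlux hHlip (graphSolution hHpos hHlip z) _)) ⟨p, rfl⟩ := fun p => by
    rw [hval, hflux]
    simp only [vertexResidual, ContinuousLinearMap.coe_pi', sum_apply,
      add_apply, smul_apply, smul_eq_mul, Pi.add_apply,
      Matrix.mulVec, dotProduct, Finset.sum_add_distrib, mul_assoc]
  constructor
  · rintro ⟨-, h⟩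
    exact funext fun p => by rw [hres, h, Pi.zero_apply, Pi.zero_apply]
  · refine fun h => ⟨graphSolution_mem_H2 hHpos hHlip z, fun v => funext ?_⟩
    rintro ⟨p, rfl⟩
    rw [← hres, h, Pi.zero_apply, Pi.zero_apply]

lemma operator_graphSolution (κ : G.LInfty) {A B : ∀ v, Matrix (G.EdgeEnd v) (G.EdgeEnd v) ℝ}
    {z : G.CauchyData}
    (hz : graphSolution hHpos hHlip z ∈ (G.operator H hHlip κ A B).domain) (e : E) :
    G.operator H hHlip κ A B ⟨_, hz⟩ e = dataRhs e z +
      (κ e • (κ e • graphSolution hHpos hHlip z e : L2Interval (G.len e)) :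
        L2Interval (G.len e)) := by
  change (κ e • (κ e • graphSolution hHpos hHlip z e : L2Interval (G.len e)) :
      L2Interval (G.len e)) - weakDeriv (G.edgeCoeff hHlip e •
        weakDeriv (graphSolution hHpos hHlip z e) : L2Interval (G.len e)) = _
  rw [edgeCoeff_smul_weakDeriv_graphSolution, weakDeriv_edgeFlux, sub_neg_eq_add, add_comm]

/-- Multiplication by `κ²` in `L₂(Γ)`. -/
noncomputable def potential (κ : G.LInfty) : G.L2 →L[ℝ] G.L2 :=
  (PiLp.continuousLinearEquiv 2 ℝ fun e : E => L2Interval (G.len e)).symm.toContinuousLinearMap ∘L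
    ContinuousLinearMap.pi fun e => mulL (κ e) ∘L mulL (κ e) ∘L
      PiLp.proj 2 (fun e : E => L2Interval (G.len e)) e

/-- If the operator is injective, then it has a compact right inverse. -/
lemma exists_compact_rightInverse_operator (hHpos : ∀ p, 0 < H p)
    (hHlip : ∃ K : ℝ≥0, LipschitzWith K H) (κ : G.LInfty)
    {A B : ∀ v, Matrix (G.EdgeEnd v) (G.EdgeEnd v) ℝ}
    (hinj : ∀ u : (G.operator H hHlip κ A B).domain, G.operator H hHlip κ A B u = 0 → u = 0) :
    ∃ K : G.L2 →L[ℝ] G.L2, IsCompactOperator K ∧ ∀ f,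
      ∃ h : K f ∈ (G.operator H hHlip κ A B).domain, G.operator H hHlip κ A B ⟨K f, h⟩ = f := by
  -- Subtracting the initial data in the second component makes `z + C z` equal to the pair of `g +
  -- κ² u` and the vertex residual. That component has finite-dimensional range, so `C` stays
  -- compact.
  let C : G.CauchyData →L[ℝ] G.CauchyData :=
    (potential κ ∘L graphSolution hHpos hHlip).prod
      (vertexResidual hHpos hHlip A B - ContinuousLinearMap.snd ℝ _ _)
  have hC : IsCompactOperator C :=
    ((isCompactOperator_graphSolution hHpos hHlip).clm_comp (potential κ)).prodMk
      (isCompactOperator_of_locallyCompactSpace_dom _)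
  have hsolve : ∀ z f, z + C z = (f, 0) →
      ∃ h : graphSolution hHpos hHlip z ∈ (G.operator H hHlip κ A B).domain,
        G.operator H hHlip κ A B ⟨_, h⟩ = f := fun z f hz => by
    have h1 : z.1 + potential κ (graphSolution hHpos hHlip z) = f := congrArg Prod.fst hz
    have h2 : z.2 + (vertexResidual hHpos hHlip A B z - z.2) = 0 := congrArg Prod.snd hz
    rw [add_sub_cancel] at h2
    have hmem := (graphSolution_mem_operatorDomain_iff hHpos hHlip z).2 h2
    refine ⟨hmem, PiLp.ext fun e => ?_⟩
    rw [operator_graphSolution hHpos hHlip κ hmem, ← h1]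
    rfl
  -- A solution of `z + C z = 0` produces `u` in the domain with `L u = 0`, so `u = 0`, and then the
  -- data `z` vanish as well.
  obtain ⟨N, hN⟩ := hC.exists_rightInverse_of_injective fun z hz => by
    obtain ⟨h, h'⟩ := hsolve z 0 hz
    exact eq_zero_of_graphSolution_eq_zero hHpos hHlip (congrArg Subtype.val (hinj _ h'))
  -- `f` enters with zero residual, the system is solved for the data, and the compact solution map
  -- recovers `u`.
  refine ⟨graphSolution hHpos hHlip ∘L N ∘L ContinuousLinearMap.inl ℝ _ _,
    (isCompactOperator_graphSolution hHpos hHlip).comp_clm (N ∘L ContinuousLinearMap.inl ℝ _ _),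
    fun f => hsolve _ f (hN (f, 0))⟩

end MetricGraph

/-! ### Self-adjointness, positivity and compact inverse of `L`. -/

theorem mainTheorem2 {V E : Type*} [Fintype V] [DecidableEq V] [Fintype E] [DecidableEq E]
    (G : MetricGraph V E)
    (H : G.Point → ℝ) (hHpos : ∀ p, 0 < H p) (hHlip : ∃ K : ℝ≥0, LipschitzWith K H)
    (κ : G.LInfty) (κ₀ : ℝ) (hκ₀ : 0 < κ₀)
    (hκ : ∀ e, ∀ᵐ x ∂(intervalMeasure (G.len e)), κ₀ ≤ κ e x)
    (A B : ∀ v, Matrix (G.EdgeEnd v) (G.EdgeEnd v) ℝ)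
    (hrank : ∀ v, (Matrix.fromCols (A v) (B v)).rank = Fintype.card (G.EdgeEnd v))
    (hAB : ∀ v, (A v * (B v).conjTranspose).IsHermitian)
    (hass : G.LengthBounds H κ₀ A B ∨ G.NonposVertex A B) :
    Dense ((G.operator H hHlip κ A B).domain : Set G.L2) ∧
      IsSelfAdjoint (G.operator H hHlip κ A B) ∧
      (∀ u : (G.operator H hHlip κ A B).domain, u ≠ 0 →
        0 < inner ℝ (G.operator H hHlip κ A B u) (u : G.L2)) ∧
      HasCompactInverse (G.operator H hHlip κ A B) := by
  have hpos := MetricGraph.inner_operator_pos hHpos hHlip hκ₀ hκ hrank hAB hass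
  have hsym := MetricGraph.isFormalAdjoint_operator hHlip (κ := κ) hrank hAB
  obtain ⟨K, hK, hLK⟩ := MetricGraph.exists_compact_rightInverse_operator hHpos hHlip κ
    (A := A) (B := B) fun u hu => by
      by_contra hne
      simpa [hu] using hpos u hne
  obtain ⟨h1, h2, h3⟩ := hsym.isSelfAdjoint_and_hasCompactInverse hpos hK hLK
  exact ⟨h1, h2, hpos, h3⟩
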